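/- Let $d\in\mathbb{N}$ and let $1<p<\infty$. Let $\mu,\nu$ be Borel probability measures on $\mathbb{R}^d$, with $\mu$ of compact support. Let $$D_p\mu=\liminf_{n\to\infty}\frac{\log_2\sum_{I\in\mathcal{D}_n}\mu(I)^p}{(1-p)\,n}$$ be the (lower) $L^p$ dimension of $\mu$, where $\mathcal{D}_n$ is the partition of $\mathbb{R}^d$ into half-open dyadic cubes of side length $2^{-n}$, and let $$\dim_F\nu=\sup\{\sigma\ge 0:\ \widehat{\nu}(\xi)=O(|\xi|^{-\sigma/2})\text{ as }|\xi|\to\infty\}\in[0,+\infty],\qquad \widehat{\nu}(\xi)=\int e^{i\pi\langle x,\xi\rangle}\,d\nu(x),$$ be the Fourier dimension of $\nu$. If $$d-D_p\mu<\dim_F\nu\quad\text{when } 1<p\le 2,$$ $$(p-1)(d-D_p\mu)<\dim_F\nu\quad\text{when } p>2,$$ then the convolution $\mu*\nu$ is absolutely continuous with respect to Lebesgue measure, with a density in $L^p(\mathbb{R}^d)$. In particular, this is the case if $D_p\mu=d$ and $\dim_F\nu>0$. -/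

import Mathlib

open MeasureTheory Filter
open scoped MeasureTheory

noncomputable section

/-- The half-open dyadic cube of side length `2 ^ (-n)` in `ℝ^d` with lower corner `2 ^ (-n) k`.
For fixed `n` these cubes form a partition of `ℝ^d`. -/
def dyadicCube {d : ℕ} (n : ℕ) (k : Fin d → ℤ) : Set (EuclideanSpace ℝ (Fin d)) :=
  {x | ∀ i, (k i : ℝ) / 2 ^ n ≤ x i ∧ x i < ((k i : ℝ) + 1) / 2 ^ n}

/-- The moment sum `∑ μ(I) ^ q` over all dyadic cubes `I` of side length `2 ^ (-n)`. -/
def dyadicMomentSum {d : ℕ} (q : ℝ) (μ : Measure (EuclideanSpace ℝ (Fin d))) (n : ℕ) : ℝ :=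
  ∑' k : Fin d → ℤ, (μ.real (dyadicCube n k)) ^ q

/-- The lower `L^q` dimension `liminf_n log₂ (∑ μ(I) ^ q) / ((1 - q) n)` of a compactly supported
probability measure, for `q > 0` and `q ≠ 1`. -/
def lqDim {d : ℕ} (q : ℝ) (μ : Measure (EuclideanSpace ℝ (Fin d))) : EReal :=
  liminf (fun n : ℕ => ((Real.logb 2 (dyadicMomentSum q μ n) / ((1 - q) * n) : ℝ) : EReal)) atTop

/-- The Fourier transform `ξ ↦ ∫ exp (i π ⟨x, ξ⟩) dμ(x)` of a measure. -/
def measureFourier {d : ℕ} (μ : Measure (EuclideanSpace ℝ (Fin d)))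
    (ξ : EuclideanSpace ℝ (Fin d)) : ℂ :=
  ∫ x, Complex.exp (Complex.I * Real.pi * (inner ℝ x ξ : ℝ)) ∂μ

/-- The Fourier dimension: the supremum (possibly `+∞`) of all real `σ ≥ 0` such that
the Fourier transform of `μ` is `O(‖ξ‖ ^ (-σ / 2))` as `‖ξ‖ → ∞`. -/
def fourierDim {d : ℕ} (μ : Measure (EuclideanSpace ℝ (Fin d))) : EReal :=
  sSup {s : EReal | ∃ σ : ℝ, s = (σ : EReal) ∧ 0 ≤ σ ∧
    measureFourier μ =O[Bornology.cobounded (EuclideanSpace ℝ (Fin d))]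
      fun ξ => ‖ξ‖ ^ (-σ / 2)}

/-- `ρ` has a (nonnegative) density in `L^p` with respect to Lebesgue measure. -/
def HasLpDensity {d : ℕ} (p : ℝ) (ρ : Measure (EuclideanSpace ℝ (Fin d))) : Prop :=
  ∃ f : EuclideanSpace ℝ (Fin d) → ℝ, (∀ x, 0 ≤ f x) ∧ MemLp f (ENNReal.ofReal p) volume ∧
    ρ = volume.withDensity fun x => ENNReal.ofReal (f x)

end

/-!
The idea is a Littlewood–Paley decomposition of `ρ = μ ∗ ν`, carried out with Gaussians only. Let
`Fₙ` be the smoothing of `ρ` at scale `2 ^ (-n)`, with Fourier multiplier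
`1 - (1 - exp (-‖ξ‖² / 4 ^ n)) ^ M`. It is a finite linear combination of heat extensions of `ρ`,
and the multiplier of `Fₙ₊₁ - Fₙ` lives at frequencies `‖ξ‖ ∼ 2 ^ n`: it vanishes to the order
`2 M` at the origin and decays like a Gaussian. If `∑ ‖Fₙ₊₁ - Fₙ‖_p < ∞`, then `Fₙ` converges in
`L^p`, and as it converges weakly to `ρ`, the limit is a density of `ρ`.

To estimate `Fₙ₊₁ - Fₙ`, suppose first that every dyadic cube of side length `2 ^ (-n)` has mass
at most `m` for `μ`, and let `W` be the total mass of `μ`. Trivially, the `L¹` norm is `O(W)` and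
the `L^∞` norm is `O(2 ^ (n d) m)` (`heatExtension_le_of_dyadicCube_le`). If moreover
`|ν̂(ξ)|² = O(‖ξ‖ ^ (-σ))`, then Plancherel's identity (`integral_heatCombination_sq`) bounds the
square of the `L²` norm by `O(2 ^ (-n σ))` times a Gaussian energy of `μ` at scale `2 ^ (-n)`,
hence by `O(2 ^ (-n σ) 2 ^ (n d) m W)`. Hölder's inequality between `L²` and `L¹` (for `p ≤ 2`) or
`L^∞` (for `p ≥ 2`) bounds the `p`-th power of the `L^p` norm by
`O(2 ^ (n (d (p - 1) - σ min(1, p - 1))) m ^ (p - 1) W)`; this is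
`exists_lintegral_smoothingDiff_conv_le`.

A general `μ` is split into the parts where the masses of the cubes lie in
`(2 ^ (-j - 1), 2 ^ (-j)]`, for `j < J = O(n)`, and a remainder where they are at most `2 ^ (-J)`.
On each of the former parts, `m ^ (p - 1) W` is bounded by the moment sum `∑ μ(I) ^ p` up to a
constant, and on the remainder it is at most `2 ^ (-J (p - 1))`. This replaces an interpolation
theorem and costs only the factor `J + 1` (`exists_eLpNorm_smoothingDiff_conv_le`). For
`D < D_p μ` the moment sum is eventually at most `2 ^ (-n (p - 1) D)`, so the norms of `Fₙ₊₁ - Fₙ`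
are dominated by a linear factor times a geometric sequence as soon as
`(p - 1) (d - D) < σ min(1, p - 1)` (`absolutelyContinuous_conv_of_decay`). This is the hypothesis
of the theorem in both ranges of `p`.
-/

open Module (finrank)
open scoped ENNReal Topology CompactlySupported

/-! ### The heat kernel -/

section HeatKernel

variable {V : Type*} [NormedAddCommGroup V] [InnerProductSpace ℝ V]

/-- The heat kernel `(4πt)^{-d/2} exp(-‖x‖² / (4t))` at time `t` on a `d`-dimensional inner product
space. With respect to the pairing `exp (i ⟨x, ξ⟩)` its Fourier transform is `exp (-t ‖ξ‖²)`. -/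
noncomputable def heatKernel (t : ℝ) (x : V) : ℝ :=
  (4 * Real.pi * t) ^ (-(finrank ℝ V : ℝ) / 2) * Real.exp (-(4 * t)⁻¹ * ‖x‖ ^ 2)

lemma heatKernel_pos {t : ℝ} (ht : 0 < t) (x : V) : 0 < heatKernel t x := by
  unfold heatKernel; positivity

lemma heatKernel_nonneg {t : ℝ} (ht : 0 < t) (x : V) : 0 ≤ heatKernel t x :=
  (heatKernel_pos ht x).le

@[fun_prop]
lemma continuous_heatKernel (t : ℝ) : Continuous (heatKernel t : V → ℝ) := by
  unfold heatKernel; fun_prop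

lemma heatKernel_le {t : ℝ} (ht : 0 < t) (x : V) :
    heatKernel t x ≤ (4 * Real.pi * t) ^ (-(finrank ℝ V : ℝ) / 2) := by
  unfold heatKernel
  apply mul_le_of_le_one_right (by positivity)
  rw [Real.exp_le_one_iff, neg_mul, neg_nonpos]
  positivity

lemma heatKernel_sub_comm (t : ℝ) (x y : V) : heatKernel t (x - y) = heatKernel t (y - x) := by
  unfold heatKernel; rw [norm_sub_rev]

/-- At time `t`, displacements of length at most `r` change the heat kernel by a bounded factor when
`r² ≤ 4 t R`, provided that the time is doubled. -/
lemma heatKernel_le_of_norm_sub_le {t r R : ℝ} (ht : 0 < t) (hr : r ^ 2 ≤ 4 * t * R)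
    {x y : V} (hxy : ‖y - x‖ ≤ r) :
    heatKernel t x ≤ 2 ^ ((finrank ℝ V : ℝ) / 2) * Real.exp R * heatKernel (2 * t) y := by
  unfold heatKernel
  have h1 : (4 * Real.pi * (2 * t)) ^ (-(finrank ℝ V : ℝ) / 2)
      = 2 ^ (-(finrank ℝ V : ℝ) / 2) * (4 * Real.pi * t) ^ (-(finrank ℝ V : ℝ) / 2) := by
    rw [← Real.mul_rpow (by norm_num) (by positivity)]; congr 1; ring
  have h2 : (2 : ℝ) ^ ((finrank ℝ V : ℝ) / 2) * 2 ^ (-(finrank ℝ V : ℝ) / 2) = 1 := by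
    rw [← Real.rpow_add (by norm_num)]; simp [neg_div]
  have h3 : ‖y‖ ^ 2 ≤ 2 * ‖x‖ ^ 2 + 2 * r ^ 2 := by
    have : ‖y‖ ≤ ‖x‖ + r := by
      calc ‖y‖ = ‖x + (y - x)‖ := by congr 1; abel
        _ ≤ ‖x‖ + ‖y - x‖ := norm_add_le _ _
        _ ≤ _ := by gcongr
    nlinarith [sq_nonneg (‖x‖ - r), norm_nonneg y, norm_nonneg x]
  have h4 : -(4 * t)⁻¹ * ‖x‖ ^ 2 ≤ R + -(4 * (2 * t))⁻¹ * ‖y‖ ^ 2 := by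
    have h5 : (4 * (2 * t))⁻¹ * ‖y‖ ^ 2 ≤ (4 * (2 * t))⁻¹ * (2 * ‖x‖ ^ 2 + 2 * (4 * t * R)) := by
      gcongr; linarith
    have h6 : (4 * (2 * t))⁻¹ * (2 * ‖x‖ ^ 2 + 2 * (4 * t * R)) = (4 * t)⁻¹ * ‖x‖ ^ 2 + R := by
      field_simp
    linarith
  calc (4 * Real.pi * t) ^ (-(finrank ℝ V : ℝ) / 2) * Real.exp (-(4 * t)⁻¹ * ‖x‖ ^ 2)
      ≤ (4 * Real.pi * t) ^ (-(finrank ℝ V : ℝ) / 2)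
        * (Real.exp R * Real.exp (-(4 * (2 * t))⁻¹ * ‖y‖ ^ 2)) := by
        rw [← Real.exp_add]; gcongr
    _ = (2 ^ ((finrank ℝ V : ℝ) / 2) * 2 ^ (-(finrank ℝ V : ℝ) / 2)) *
        ((4 * Real.pi * t) ^ (-(finrank ℝ V : ℝ) / 2)
        * (Real.exp R * Real.exp (-(4 * (2 * t))⁻¹ * ‖y‖ ^ 2))) := by rw [h2, one_mul]
    _ = _ := by rw [h1]; ring

variable [FiniteDimensional ℝ V] [MeasurableSpace V] [BorelSpace V]

lemma integrable_exp_neg_mul_sq_norm {b : ℝ} (hb : 0 < b) :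
    Integrable (fun x : V ↦ Real.exp (-b * ‖x‖ ^ 2)) := by
  have h := (GaussianFourier.integrable_cexp_neg_mul_sq_norm_add (V := V) (b := b)
    (by simpa using hb) 0 0).norm
  refine h.congr (ae_of_all _ fun x ↦ ?_)
  simp only [Complex.norm_exp]
  norm_cast
  simp

lemma integral_heatKernel {t : ℝ} (ht : 0 < t) : ∫ x : V, heatKernel t x = 1 := by
  unfold heatKernel
  rw [integral_const_mul, GaussianFourier.integral_rexp_neg_mul_sq_norm (by positivity)]
  rw [show Real.pi / (4 * t)⁻¹ = 4 * Real.pi * t by field_simp, ← Real.rpow_add (by positivity)]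
  simp [neg_div]

lemma integrable_heatKernel {t : ℝ} (ht : 0 < t) : Integrable (heatKernel t : V → ℝ) :=
  (integrable_exp_neg_mul_sq_norm (by positivity)).const_mul _

lemma lintegral_heatKernel_sub {t : ℝ} (ht : 0 < t) (y : V) :
    ∫⁻ x : V, ENNReal.ofReal (heatKernel t (x - y)) = 1 := by
  rw [lintegral_sub_right_eq_self (fun x : V ↦ ENNReal.ofReal (heatKernel t x)) y,
    ← ofReal_integral_eq_lintegral_ofReal (integrable_heatKernel ht)
      (ae_of_all _ (heatKernel_nonneg ht)), integral_heatKernel ht, ENNReal.ofReal_one]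

/-- The semigroup property of the heat kernel. -/
lemma integral_heatKernel_mul_heatKernel {t s : ℝ} (ht : 0 < t) (hs : 0 < s) (y z : V) :
    ∫ x : V, heatKernel t (x - y) * heatKernel s (x - z) = heatKernel (t + s) (y - z) := by
  set b : ℝ := (4 * t)⁻¹ + (4 * s)⁻¹ with hb
  have hb0 : 0 < b := by positivity
  have hbe : b = (t + s) / (4 * t * s) := by rw [hb]; field_simp; ring
  rw [← integral_add_right_eq_self _ y]
  have hpt : ∀ x : V, heatKernel t (x + y - y) * heatKernel s (x + y - z) =
      ((4 * Real.pi * t) ^ (-(finrank ℝ V : ℝ) / 2) * (4 * Real.pi * s) ^ (-(finrank ℝ V : ℝ) / 2)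
        * Real.exp (-(4 * s)⁻¹ * ‖y - z‖ ^ 2)) *
        Real.exp (-b * ‖x‖ ^ 2 + (-(2 * s)⁻¹) * inner ℝ (y - z) x) := by
    intro x
    unfold heatKernel
    rw [add_sub_cancel_right, add_sub_assoc, norm_add_sq_real, real_inner_comm]
    have : ∀ A B p q r s' : ℝ, p + q = r + s' → A * Real.exp p * (B * Real.exp q) =
      A * B * Real.exp r * Real.exp s' := by
      intro A B p q r s' h
      calc A * Real.exp p * (B * Real.exp q) = A * B * (Real.exp p * Real.exp q) := by ring
        _ = A * B * (Real.exp r * Real.exp s') := by rw [← Real.exp_add, h, Real.exp_add]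
        _ = _ := by ring
    apply this
    rw [hb]; field_simp; ring
  have hint : ∫ x : V, Real.exp (-b * ‖x‖ ^ 2 + (-(2 * s)⁻¹) * inner ℝ (y - z) x) =
      (Real.pi / b) ^ ((finrank ℝ V : ℝ) / 2)
        * Real.exp ((-(2 * s)⁻¹) ^ 2 * ‖y - z‖ ^ 2 / (4 * b)) := by
    have h := GaussianFourier.integral_cexp_neg_mul_sq_norm_add (V := V) (b := b)
      (by simpa using hb0) ((-(2 * s)⁻¹ : ℝ) : ℂ) (y - z)
    apply Complex.ofReal_injective
    rw [← integral_complex_ofReal]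
    push_cast [Complex.ofReal_cpow (show 0 ≤ Real.pi / b by positivity)]
    push_cast at h
    exact h
  simp_rw [hpt]
  rw [integral_const_mul, hint]
  unfold heatKernel
  have e1 : (4 * Real.pi * t) ^ (-(finrank ℝ V : ℝ) / 2)
      * (4 * Real.pi * s) ^ (-(finrank ℝ V : ℝ) / 2) * (Real.pi / b) ^ ((finrank ℝ V : ℝ) / 2)
      = (4 * Real.pi * (t + s)) ^ (-(finrank ℝ V : ℝ) / 2) := by
    rw [neg_div, ← inv_inv ((Real.pi / b) ^ ((finrank ℝ V : ℝ) / 2)),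
      ← Real.rpow_neg (by positivity), ← Real.inv_rpow (by positivity),
      ← Real.mul_rpow (by positivity) (by positivity),
      ← Real.mul_rpow (by positivity) (by positivity)]
    congr 1
    rw [hbe]; field_simp
  have e2 : Real.exp (-(4 * s)⁻¹ * ‖y - z‖ ^ 2)
      * Real.exp ((-(2 * s)⁻¹) ^ 2 * ‖y - z‖ ^ 2 / (4 * b))
      = Real.exp (-(4 * (t + s))⁻¹ * ‖y - z‖ ^ 2) := by
    rw [← Real.exp_add]
    congr 1
    rw [hbe]; field_simp; ring
  rw [← e1, ← e2]; ring

/-- The heat kernel as the inverse Fourier transform of the Gaussian `exp (-t ‖ξ‖²)`. -/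
lemma heatKernel_eq_integral {t : ℝ} (ht : 0 < t) (x : V) :
    ((heatKernel t x : ℝ) : ℂ) = ((2 * Real.pi) ^ (-(finrank ℝ V : ℝ)) : ℝ) *
      ∫ ξ : V, Complex.exp (-t * ‖ξ‖ ^ 2 + Complex.I * (inner ℝ x ξ : ℝ)) := by
  rw [GaussianFourier.integral_cexp_neg_mul_sq_norm_add (by simpa using ht)]
  unfold heatKernel
  have h1 : ((Real.pi : ℂ) / t) ^ ((finrank ℝ V : ℂ) / 2)
      = ((Real.pi / t) ^ ((finrank ℝ V : ℝ) / 2) : ℝ) := by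
    push_cast [Complex.ofReal_cpow (show 0 ≤ Real.pi / t by positivity)]; rfl
  have h2 : Complex.exp (Complex.I ^ 2 * ‖x‖ ^ 2 / (4 * t)) =
      (Real.exp (-(4 * t)⁻¹ * ‖x‖ ^ 2) : ℝ) := by
    rw [Complex.I_sq]; push_cast; congr 1; field_simp
  rw [h1, h2, ← Complex.ofReal_mul, ← Complex.ofReal_mul, Complex.ofReal_inj, ← mul_assoc]
  congr 1
  have h3 : ((2 * Real.pi) ^ 2 : ℝ) ^ (-((finrank ℝ V : ℝ)) / 2) =
      (2 * Real.pi) ^ (-(finrank ℝ V : ℝ)) := by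
    rw [← Real.rpow_natCast, ← Real.rpow_mul (by positivity)]; congr 1; push_cast; ring
  rw [← h3, ← inv_inv ((Real.pi / t) ^ ((finrank ℝ V : ℝ) / 2)),
      ← Real.rpow_neg (by positivity), ← Real.inv_rpow (by positivity), neg_div,
      ← Real.mul_rpow (by positivity) (by positivity)]
  congr 1
  field_simp; ring

end HeatKernel

/-! ### Heat extensions of measures -/

section HeatExtension

variable {V : Type*} [NormedAddCommGroup V] [InnerProductSpace ℝ V] [MeasurableSpace V]

/-- The convolution of a measure with the heat kernel at time `t`, as a function. -/
noncomputable def heatExtension (t : ℝ) (μ : Measure V) (x : V) : ℝ :=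
  ∫ y, heatKernel t (x - y) ∂μ

lemma heatExtension_nonneg {t : ℝ} (μ : Measure V) (ht : 0 < t) (x : V) : 0 ≤ heatExtension t μ x :=
  integral_nonneg fun _ ↦ heatKernel_nonneg ht _

variable [FiniteDimensional ℝ V] [BorelSpace V]

variable (μ ν : Measure V) [IsFiniteMeasure μ] [IsFiniteMeasure ν] {t s : ℝ}

lemma integrable_heatKernel_sub_left (ht : 0 < t) (x : V) :
    Integrable (fun y ↦ heatKernel t (x - y)) μ := by
  refine Integrable.of_bound (by fun_prop) ((4 * Real.pi * t) ^ (-(finrank ℝ V : ℝ) / 2))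
    (ae_of_all _ fun y ↦ ?_)
  rw [Real.norm_of_nonneg (heatKernel_nonneg ht _)]
  exact heatKernel_le ht _

lemma ofReal_heatExtension (ht : 0 < t) (x : V) :
    ENNReal.ofReal (heatExtension t μ x) = ∫⁻ y, ENNReal.ofReal (heatKernel t (x - y)) ∂μ :=
  ofReal_integral_eq_lintegral_ofReal (integrable_heatKernel_sub_left μ ht x)
    (ae_of_all _ fun _ ↦ heatKernel_nonneg ht _)

@[fun_prop]
lemma measurable_heatExtension (t : ℝ) : Measurable (heatExtension t μ) := by
  have : Measurable (fun q : V × V ↦ heatKernel t (q.1 - q.2)) := by fun_prop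
  exact this.stronglyMeasurable.integral_prod_right.measurable

lemma lintegral_heatExtension (ht : 0 < t) :
    ∫⁻ x, ENNReal.ofReal (heatExtension t μ x) = μ Set.univ := by
  simp_rw [ofReal_heatExtension μ ht]
  rw [lintegral_lintegral_swap (by fun_prop)]
  simp [lintegral_heatKernel_sub ht]

lemma integrable_heatExtension (ht : 0 < t) : Integrable (heatExtension t μ) := by
  refine ⟨by fun_prop, ?_⟩
  rw [hasFiniteIntegral_iff_ofReal (ae_of_all _ (heatExtension_nonneg μ ht)),
    lintegral_heatExtension μ ht]
  exact measure_lt_top _ _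

lemma heatExtension_le (ht : 0 < t) (x : V) :
    heatExtension t μ x ≤ (4 * Real.pi * t) ^ (-(finrank ℝ V : ℝ) / 2) * μ.real Set.univ := by
  calc heatExtension t μ x ≤ ∫ _, (4 * Real.pi * t) ^ (-(finrank ℝ V : ℝ) / 2) ∂μ :=
        integral_mono (integrable_heatKernel_sub_left μ ht x) (integrable_const _)
          fun y ↦ heatKernel_le ht _
    _ = _ := by simp [mul_comm]

lemma heatExtension_finset_sum {ι : Type*} (s : Finset ι) (μ : ι → Measure V)
    [∀ i, IsFiniteMeasure (μ i)] (ht : 0 < t) (x : V) :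
    heatExtension t (∑ i ∈ s, μ i) x = ∑ i ∈ s, heatExtension t (μ i) x :=
  integral_finsetSum_measure fun i _ ↦ integrable_heatKernel_sub_left (μ i) ht x

lemma ofReal_heatExtension_conv (ht : 0 < t) (x : V) :
    ENNReal.ofReal (heatExtension t (μ ∗ ν) x)
      = ∫⁻ z, ENNReal.ofReal (heatExtension t μ (x - z)) ∂ν := by
  rw [ofReal_heatExtension _ ht, Measure.lintegral_conv (by fun_prop),
    lintegral_lintegral_swap (by fun_prop)]
  refine lintegral_congr fun z ↦ ?_
  rw [ofReal_heatExtension _ ht]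
  refine lintegral_congr fun y ↦ ?_
  rw [sub_sub, add_comm]

lemma heatExtension_conv_le (κ : Measure V) [IsProbabilityMeasure κ] (ht : 0 < t) {B : ℝ}
    (hB : ∀ x, heatExtension t μ x ≤ B) (x : V) : heatExtension t (μ ∗ κ) x ≤ B := by
  have hB0 : 0 ≤ B := (heatExtension_nonneg μ ht x).trans (hB x)
  rw [← ENNReal.ofReal_le_ofReal_iff hB0, ofReal_heatExtension_conv _ _ ht]
  calc ∫⁻ z, ENNReal.ofReal (heatExtension t μ (x - z)) ∂κ
      ≤ ∫⁻ _, ENNReal.ofReal B ∂κ := lintegral_mono fun z ↦ ENNReal.ofReal_le_ofReal (hB _)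
    _ = _ := by simp

lemma integrable_heatExtension_mul (ht : 0 < t) (hs : 0 < s) :
    Integrable (fun x ↦ heatExtension t μ x * heatExtension s μ x) := by
  refine (integrable_heatExtension μ ht).mul_bdd (by fun_prop)
    (ae_of_all _ fun x ↦ ?_) (c := (4 * Real.pi * s) ^ (-(finrank ℝ V : ℝ) / 2) * μ.real Set.univ)
  rw [Real.norm_of_nonneg (heatExtension_nonneg μ hs x)]
  exact heatExtension_le μ hs x

/-- By the semigroup property, `L²` pairings of heat extensions are Gaussian energies. -/
lemma integral_heatExtension_mul (ht : 0 < t) (hs : 0 < s) :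
    ∫ x, heatExtension t μ x * heatExtension s μ x = ∫ y, heatExtension (t + s) μ y ∂μ := by
  rw [integral_eq_lintegral_of_nonneg_ae (ae_of_all _ fun x ↦
      mul_nonneg (heatExtension_nonneg μ ht x) (heatExtension_nonneg μ hs x)) (by fun_prop),
    integral_eq_lintegral_of_nonneg_ae
      (ae_of_all _ fun x ↦ heatExtension_nonneg μ (add_pos ht hs) x) (by fun_prop)]
  congr 1
  have h1 : ∀ x, ENNReal.ofReal (heatExtension t μ x * heatExtension s μ x) =
      ∫⁻ y, ∫⁻ z, ENNReal.ofReal (heatKernel t (x - y) * heatKernel s (x - z)) ∂μ ∂μ := by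
    intro x
    rw [ENNReal.ofReal_mul (heatExtension_nonneg μ ht x), ofReal_heatExtension μ ht,
      ofReal_heatExtension μ hs, ← lintegral_mul_const _ (by fun_prop)]
    refine lintegral_congr fun y ↦ ?_
    rw [← lintegral_const_mul _ (by fun_prop)]
    refine lintegral_congr fun z ↦ ?_
    rw [ENNReal.ofReal_mul (heatKernel_nonneg ht _)]
  simp_rw [h1, ofReal_heatExtension μ (add_pos ht hs)]
  have hm : Measurable (fun q : V × V × V ↦
      ENNReal.ofReal (heatKernel t (q.1 - q.2.1) * heatKernel s (q.1 - q.2.2))) := by fun_prop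
  rw [lintegral_lintegral_swap]
  · refine lintegral_congr fun y ↦ ?_
    rw [lintegral_lintegral_swap (by fun_prop)]
    refine lintegral_congr fun z ↦ ?_
    rw [← integral_heatKernel_mul_heatKernel ht hs, ofReal_integral_eq_lintegral_ofReal]
    · refine ((integrable_heatKernel (V := V) ht).comp_sub_right y).mul_bdd (by fun_prop)
        (ae_of_all _ fun x ↦ ?_) (c := (4 * Real.pi * s) ^ (-(finrank ℝ V : ℝ) / 2))
      rw [Real.norm_of_nonneg (heatKernel_nonneg hs _)]
      exact heatKernel_le hs _
    · exact ae_of_all _ fun x ↦ mul_nonneg (heatKernel_nonneg ht _) (heatKernel_nonneg hs _)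
  · refine Measurable.aemeasurable ?_
    refine Measurable.lintegral_prod_right' (f := fun q : (V × V) × V ↦
      ENNReal.ofReal (heatKernel t (q.1.1 - q.1.2) * heatKernel s (q.1.1 - q.2))) ?_
    fun_prop

lemma integrable_exp_mul_charFun_sq {t : ℝ} (ht : 0 < t) :
    Integrable (fun ξ : V ↦ Real.exp (-t * ‖ξ‖ ^ 2) * ‖charFun μ ξ‖ ^ 2) := by
  refine (integrable_exp_neg_mul_sq_norm ht).mul_bdd (c := μ.real Set.univ ^ 2)
    (by fun_prop) (ae_of_all _ fun ξ ↦ ?_)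
  rw [Real.norm_of_nonneg (by positivity)]
  gcongr
  exact norm_charFun_le ξ

/-- The Gaussian energy of a measure in terms of its characteristic function. -/
lemma integral_heatExtension_self (ht : 0 < t) :
    ∫ x, heatExtension t μ x ∂μ = (2 * Real.pi) ^ (-(finrank ℝ V : ℝ)) *
      ∫ ξ : V, Real.exp (-t * ‖ξ‖ ^ 2) * ‖charFun μ ξ‖ ^ 2 := by
  have hint : Integrable (fun q : V × V ↦ heatKernel t (q.1 - q.2)) (μ.prod μ) := by
    refine Integrable.of_bound (by fun_prop) ((4 * Real.pi * t) ^ (-(finrank ℝ V : ℝ) / 2))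
      (ae_of_all _ fun y ↦ ?_)
    rw [Real.norm_of_nonneg (heatKernel_nonneg ht _)]
    exact heatKernel_le ht _
  unfold heatExtension
  rw [← integral_prod (fun q : V × V ↦ heatKernel t (q.1 - q.2)) hint]
  apply Complex.ofReal_injective
  rw [← integral_complex_ofReal, Complex.ofReal_mul, ← integral_complex_ofReal]
  simp_rw [heatKernel_eq_integral ht]
  rw [integral_const_mul]
  congr 1
  rw [integral_integral_swap]
  · refine integral_congr_ae (ae_of_all _ fun ξ ↦ ?_)
    have hpt : ∀ q : V × V, Complex.exp (-t * ‖ξ‖ ^ 2 + Complex.I * (inner ℝ (q.1 - q.2) ξ : ℝ)) =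
        Complex.exp (-t * ‖ξ‖ ^ 2) * (Complex.exp ((inner ℝ q.1 ξ : ℝ) * Complex.I) *
          Complex.exp ((inner ℝ q.2 (-ξ) : ℝ) * Complex.I)) := by
      intro q
      rw [← Complex.exp_add, ← Complex.exp_add, inner_sub_left, inner_neg_right]
      congr 1
      push_cast; ring
    simp only [hpt]
    rw [integral_const_mul, integral_prod_mul (fun x : V ↦ Complex.exp ((inner ℝ x ξ : ℝ)
      * Complex.I)) (fun x : V ↦ Complex.exp ((inner ℝ x (-ξ) : ℝ) * Complex.I)),
      ← charFun_apply, ← charFun_apply, charFun_neg, Complex.mul_conj, Complex.normSq_eq_norm_sq]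
    push_cast
    rfl
  · have h : Integrable (fun q : (V × V) × V ↦ (1 : ℝ) * Real.exp (-t * ‖q.2‖ ^ 2))
        ((μ.prod μ).prod volume) :=
      (integrable_const (1 : ℝ)).mul_prod (integrable_exp_neg_mul_sq_norm ht)
    refine h.mono' ?_ (ae_of_all _ fun q ↦ ?_)
    · refine Continuous.aestronglyMeasurable ?_
      unfold Function.uncurry
      fun_prop
    · simp only [Function.uncurry, Complex.norm_exp]
      simp [← Complex.ofReal_pow]

end HeatExtension

/-! ### Dyadic cubes -/

section DyadicCubes

variable {d : ℕ}

/-- The index `k` of the dyadic cube of side length `2 ^ (-n)` that contains `x`. -/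
noncomputable def dyadicIndex (n : ℕ) (x : EuclideanSpace ℝ (Fin d)) : Fin d → ℤ :=
  fun i ↦ ⌊2 ^ n * x i⌋

@[fun_prop]
lemma measurable_dyadicIndex (n : ℕ) : Measurable (dyadicIndex (d := d) n) := by
  unfold dyadicIndex; fun_prop

lemma dyadicCube_eq_preimage (n : ℕ) (k : Fin d → ℤ) :
    dyadicCube n k = dyadicIndex n ⁻¹' {k} := by
  ext x
  simp only [dyadicCube, Set.mem_ofPred_eq, Set.mem_preimage, Set.mem_singleton_iff, funext_iff,
    dyadicIndex, Int.floor_eq_iff]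
  refine forall_congr' fun i ↦ ?_
  rw [div_le_iff₀' (by positivity), lt_div_iff₀' (by positivity)]

lemma measurableSet_dyadicCube (n : ℕ) (k : Fin d → ℤ) : MeasurableSet (dyadicCube n k) := by
  rw [dyadicCube_eq_preimage]
  exact measurable_dyadicIndex n (measurableSet_singleton k)

lemma volume_dyadicCube (n : ℕ) (k : Fin d → ℤ) :
    volume (dyadicCube n k) = ENNReal.ofReal ((2 ^ n)⁻¹ ^ d) := by
  have h : dyadicCube n k = (MeasurableEquiv.toLp 2 (Fin d → ℝ)).symm ⁻¹'
      (Set.univ.pi fun i ↦ Set.Ico ((k i : ℝ) / 2 ^ n) (((k i : ℝ) + 1) / 2 ^ n)) := by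
    ext x; simp [dyadicCube]
  rw [h, (EuclideanSpace.volume_preserving_symm_measurableEquiv_toLp (Fin d)).measure_preimage
    (MeasurableSet.univ_pi fun i ↦ measurableSet_Ico).nullMeasurableSet, Real.volume_pi_Ico]
  have : ∀ i : Fin d, ((k i : ℝ) + 1) / 2 ^ n - (k i : ℝ) / 2 ^ n = (2 ^ n)⁻¹ := by
    intro i; field_simp; ring
  rw [ENNReal.ofReal_pow (by positivity)]
  simp [this]

lemma norm_sub_le_of_dyadicIndex_eq {n : ℕ} {x y : EuclideanSpace ℝ (Fin d)}
    (h : dyadicIndex n x = dyadicIndex n y) : ‖x - y‖ ≤ √d * (2 ^ n)⁻¹ := by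
  rw [EuclideanSpace.norm_eq]
  apply Real.sqrt_le_iff.2 ⟨by positivity, ?_⟩
  rw [mul_pow, Real.sq_sqrt (by positivity)]
  have : ∀ i : Fin d, ‖(x - y) i‖ ^ 2 ≤ ((2 ^ n)⁻¹ : ℝ) ^ 2 := by
    intro i
    have h1 : |2 ^ n * x i - 2 ^ n * y i| < 1 := Int.abs_sub_lt_one_of_floor_eq_floor (congrFun h i)
    rw [← mul_sub, abs_mul, abs_of_pos (by positivity)] at h1
    gcongr
    rw [PiLp.sub_apply, Real.norm_eq_abs, ← one_div, le_div_iff₀' (by positivity)]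
    exact h1.le
  calc _ ≤ ∑ _ : Fin d, ((2 ^ n)⁻¹ : ℝ) ^ 2 := Finset.sum_le_sum fun i _ ↦ this i
    _ = _ := by simp

/-- At times `t ≥ 4 ^ (-n) / 4`, the heat extension of a measure is controlled by the largest mass
it gives to a dyadic cube of side length `2 ^ (-n)`: on such a cube the heat kernel is comparable
to its average, up to doubling the time. -/
lemma heatExtension_le_of_dyadicCube_le (μ : Measure (EuclideanSpace ℝ (Fin d)))
    [IsFiniteMeasure μ] {n : ℕ} {m t : ℝ} (hm : ∀ k, μ.real (dyadicCube n k) ≤ m)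
    (ht : (4 ^ n)⁻¹ / 4 ≤ t) (x : EuclideanSpace ℝ (Fin d)) :
    heatExtension t μ x ≤ 2 ^ ((d : ℝ) / 2) * Real.exp d * (2 ^ n) ^ d * m := by
  have ht0 : 0 < t := lt_of_lt_of_le (by positivity) ht
  have hm0 : 0 ≤ m := measureReal_nonneg.trans (hm 0)
  set C : ℝ := 2 ^ ((d : ℝ) / 2) * Real.exp d with hC
  have hC0 : 0 ≤ C := by positivity
  rw [← ENNReal.ofReal_le_ofReal_iff (by positivity), ofReal_heatExtension μ ht0]
  -- replace the heat kernel by its average over the cube of `y`, then integrate in `y` first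
  have hker : ∀ y, ENNReal.ofReal (heatKernel t (x - y)) ≤
      ∫⁻ z, ENNReal.ofReal (C * (2 ^ n) ^ d) *
        {q : EuclideanSpace ℝ (Fin d) × EuclideanSpace ℝ (Fin d) |
          dyadicIndex n q.1 = dyadicIndex n q.2}.indicator
          (fun q ↦ ENNReal.ofReal (heatKernel (2 * t) (q.2 - x))) (y, z) := by
    intro y
    have hvol : ENNReal.ofReal (heatKernel t (x - y)) =
        ∫⁻ _ in dyadicCube n (dyadicIndex n y),
          ENNReal.ofReal ((2 ^ n) ^ d) * ENNReal.ofReal (heatKernel t (x - y)) := by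
      rw [setLIntegral_const, volume_dyadicCube, mul_right_comm,
        ← ENNReal.ofReal_mul (by positivity), inv_pow,
        mul_inv_cancel₀ (by positivity), ENNReal.ofReal_one, one_mul]
    rw [hvol, ← lintegral_indicator (measurableSet_dyadicCube _ _)]
    refine lintegral_mono fun z ↦ ?_
    by_cases hz : dyadicIndex n y = dyadicIndex n z
    · rw [Set.indicator_of_mem (by rw [dyadicCube_eq_preimage]; exact hz.symm),
        Set.indicator_of_mem (by exact hz), ← ENNReal.ofReal_mul (by positivity),
        ← ENNReal.ofReal_mul (by positivity)]
      apply ENNReal.ofReal_le_ofReal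
      have := heatKernel_le_of_norm_sub_le (r := √d * (2 ^ n)⁻¹) (R := d) ht0 (x := x - y)
        (y := x - z) ?_ (by rw [sub_sub_sub_cancel_left]; exact norm_sub_le_of_dyadicIndex_eq hz)
      · rw [finrank_euclideanSpace_fin, ← hC, heatKernel_sub_comm (2 * t)] at this
        calc _ ≤ (2 ^ n) ^ d * (C * heatKernel (2 * t) (z - x)) := by gcongr
          _ = _ := by ring
      · rw [mul_pow, Real.sq_sqrt (by positivity), inv_pow, ← pow_mul, mul_comm n 2, pow_mul]
        norm_num
        rw [mul_comm]
        gcongr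
        linarith
    · rw [Set.indicator_of_notMem (by rw [dyadicCube_eq_preimage]; exact fun h ↦ hz h.symm)]
      exact zero_le
  have hset : MeasurableSet {q : EuclideanSpace ℝ (Fin d) × EuclideanSpace ℝ (Fin d) |
          dyadicIndex n q.1 = dyadicIndex n q.2} :=
    measurableSet_eq_fun (by fun_prop) (by fun_prop)
  calc ∫⁻ y, ENNReal.ofReal (heatKernel t (x - y)) ∂μ ≤ _ := lintegral_mono hker
    _ = ∫⁻ z, ∫⁻ y, ENNReal.ofReal (C * (2 ^ n) ^ d) *
        {q : EuclideanSpace ℝ (Fin d) × EuclideanSpace ℝ (Fin d) |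
          dyadicIndex n q.1 = dyadicIndex n q.2}.indicator
          (fun q ↦ ENNReal.ofReal (heatKernel (2 * t) (q.2 - x))) (y, z) ∂μ := by
      rw [lintegral_lintegral_swap]
      exact ((Measurable.indicator (by fun_prop) hset).const_mul _).aemeasurable
    _ = ∫⁻ z, ENNReal.ofReal (C * (2 ^ n) ^ d) * (ENNReal.ofReal (heatKernel (2 * t) (z - x)) *
        μ (dyadicCube n (dyadicIndex n z))) := by
      refine lintegral_congr fun z ↦ ?_
      have hm' := (Measurable.indicator (f := fun q : EuclideanSpace ℝ (Fin d) ×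
        EuclideanSpace ℝ (Fin d) ↦ ENNReal.ofReal (heatKernel (2 * t) (q.2 - x)))
        (by fun_prop) hset).comp (measurable_prodMk_right (y := z))
      rw [lintegral_const_mul _ (by exact hm'),
        ← setLIntegral_const, ← lintegral_indicator (measurableSet_dyadicCube _ _),
        dyadicCube_eq_preimage]
      rfl
    _ ≤ ∫⁻ z, ENNReal.ofReal (C * (2 ^ n) ^ d) * (ENNReal.ofReal (heatKernel (2 * t) (z - x)) *
        ENNReal.ofReal m) := by
      refine lintegral_mono fun z ↦ ?_
      gcongr
      rw [ENNReal.le_ofReal_iff_toReal_le (measure_ne_top _ _) hm0]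
      exact hm _
    _ = _ := by
      rw [lintegral_const_mul _ (by fun_prop), lintegral_mul_const _ (by fun_prop),
        lintegral_heatKernel_sub (by positivity), one_mul, ← ENNReal.ofReal_mul (by positivity)]

end DyadicCubes

/-! ### Hölder interpolation of norms -/

section Interpolation

/-- An `L^p` bound with `1 ≤ p ≤ 2` from bounds in `L^1` and `L^2`. -/
lemma lintegral_enorm_rpow_le_of_le_two {α : Type*} [MeasurableSpace α] {μ : Measure α} {f : α → ℝ}
    (hf : AEMeasurable f μ) {p A₁ A₂ : ℝ} (hp : 1 ≤ p) (hp2 : p ≤ 2) (hA₁ : 0 ≤ A₁) (hA₂ : 0 ≤ A₂)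
    (h₁ : ∫⁻ x, ‖f x‖ₑ ∂μ ≤ ENNReal.ofReal A₁)
    (h₂ : ∫⁻ x, ‖f x‖ₑ ^ (2 : ℝ) ∂μ ≤ ENNReal.ofReal A₂) :
    ∫⁻ x, ‖f x‖ₑ ^ p ∂μ ≤ ENNReal.ofReal (A₁ ^ (2 - p) * A₂ ^ (p - 1)) := by
  calc ∫⁻ x, ‖f x‖ₑ ^ p ∂μ = ∫⁻ x, ‖f x‖ₑ ^ (2 - p) * (‖f x‖ₑ ^ (2 : ℝ)) ^ (p - 1) ∂μ := by
        refine lintegral_congr fun x ↦ ?_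
        rw [← ENNReal.rpow_mul, ← ENNReal.rpow_add_of_nonneg _ _ (by linarith) (by linarith)]
        congr 1; ring
    _ ≤ (∫⁻ x, ‖f x‖ₑ ∂μ) ^ (2 - p) * (∫⁻ x, ‖f x‖ₑ ^ (2 : ℝ) ∂μ) ^ (p - 1) :=
        ENNReal.lintegral_mul_norm_pow_le hf.enorm (hf.enorm.pow_const _) (by linarith)
          (by linarith) (by ring)
    _ ≤ ENNReal.ofReal A₁ ^ (2 - p) * ENNReal.ofReal A₂ ^ (p - 1) := by
        gcongr
    _ = _ := by
        rw [ENNReal.ofReal_rpow_of_nonneg hA₁ (by linarith),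
          ENNReal.ofReal_rpow_of_nonneg hA₂ (by linarith), ← ENNReal.ofReal_mul (by positivity)]

/-- An `L^p` bound with `2 ≤ p` from bounds in `L^2` and `L^∞`. -/
lemma lintegral_enorm_rpow_le_of_two_le {α : Type*} [MeasurableSpace α] {μ : Measure α} {f : α → ℝ}
    {p A₀ A₂ : ℝ} (hp : 2 ≤ p) (hA₀ : 0 ≤ A₀)
    (h₀ : ∀ x, |f x| ≤ A₀) (h₂ : ∫⁻ x, ‖f x‖ₑ ^ (2 : ℝ) ∂μ ≤ ENNReal.ofReal A₂) :
    ∫⁻ x, ‖f x‖ₑ ^ p ∂μ ≤ ENNReal.ofReal (A₀ ^ (p - 2) * A₂) := by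
  calc ∫⁻ x, ‖f x‖ₑ ^ p ∂μ ≤ ∫⁻ x, ENNReal.ofReal (A₀ ^ (p - 2)) * ‖f x‖ₑ ^ (2 : ℝ) ∂μ := by
        refine lintegral_mono fun x ↦ ?_
        have h : ‖f x‖ₑ ^ p = ‖f x‖ₑ ^ (p - 2) * ‖f x‖ₑ ^ (2 : ℝ) := by
          rw [← ENNReal.rpow_add_of_nonneg _ _ (by linarith) (by linarith)]
          congr 1; ring
        rw [h, ← ENNReal.ofReal_rpow_of_nonneg hA₀ (by linarith)]
        gcongr
        rw [Real.enorm_eq_ofReal_abs]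
        exact ENNReal.ofReal_le_ofReal (h₀ x)
    _ = ENNReal.ofReal (A₀ ^ (p - 2)) * ∫⁻ x, ‖f x‖ₑ ^ (2 : ℝ) ∂μ :=
        lintegral_const_mul' _ _ ENNReal.ofReal_ne_top
    _ ≤ ENNReal.ofReal (A₀ ^ (p - 2)) * ENNReal.ofReal A₂ := by gcongr
    _ = _ := by rw [← ENNReal.ofReal_mul (by positivity)]

end Interpolation

/-! ### Linear combinations of heat extensions -/

section HeatCombination

variable {V : Type*} [NormedAddCommGroup V] [InnerProductSpace ℝ V] [MeasurableSpace V] {ι : Type*}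

/-- A finite linear combination `∑ cᵢ e^{aᵢ Δ} μ` of heat extensions of a measure. -/
noncomputable def heatCombination (s : Finset ι) (c a : ι → ℝ) (μ : Measure V) (x : V) : ℝ :=
  ∑ i ∈ s, c i * heatExtension (a i) μ x

lemma abs_heatCombination_le (μ : Measure V) {s : Finset ι} {c a : ι → ℝ} (ha : ∀ i ∈ s, 0 < a i)
    {B : ℝ} {x : V} (hB : ∀ i ∈ s, heatExtension (a i) μ x ≤ B) :
    |heatCombination s c a μ x| ≤ (∑ i ∈ s, |c i|) * B := by
  unfold heatCombination
  rw [Finset.sum_mul]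
  refine (Finset.abs_sum_le_sum_abs _ _).trans (Finset.sum_le_sum fun i hi ↦ ?_)
  rw [abs_mul, abs_of_nonneg (heatExtension_nonneg μ (ha i hi) x)]
  gcongr
  exact hB i hi

variable [FiniteDimensional ℝ V] [BorelSpace V] (s : Finset ι) (c a : ι → ℝ)

@[fun_prop]
lemma measurable_heatCombination (μ : Measure V) [IsFiniteMeasure μ] :
    Measurable (heatCombination s c a μ) := by
  unfold heatCombination; fun_prop

lemma heatCombination_finset_sum {κ : Type*} (t : Finset κ) (μ : κ → Measure V)
    [∀ j, IsFiniteMeasure (μ j)] {s : Finset ι} {a : ι → ℝ} (ha : ∀ i ∈ s, 0 < a i) (x : V) :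
    heatCombination s c a (∑ j ∈ t, μ j) x = ∑ j ∈ t, heatCombination s c a (μ j) x := by
  unfold heatCombination
  rw [Finset.sum_comm]
  refine Finset.sum_congr rfl fun i hi ↦ ?_
  rw [heatExtension_finset_sum _ _ (ha i hi), Finset.mul_sum]

variable (μ : Measure V) [IsFiniteMeasure μ] {s c a}

lemma lintegral_enorm_heatCombination_le (ha : ∀ i ∈ s, 0 < a i) :
    ∫⁻ x, ‖heatCombination s c a μ x‖ₑ ≤
      ENNReal.ofReal ((∑ i ∈ s, |c i|) * μ.real Set.univ) := by
  calc ∫⁻ x, ‖heatCombination s c a μ x‖ₑ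
      ≤ ∫⁻ x, ∑ i ∈ s, ENNReal.ofReal |c i| * ENNReal.ofReal (heatExtension (a i) μ x) := by
        refine lintegral_mono fun x ↦ (enorm_sum_le _ _).trans (Finset.sum_le_sum fun i hi ↦ ?_)
        rw [Real.enorm_eq_ofReal_abs, abs_mul, abs_of_nonneg (heatExtension_nonneg μ (ha i hi) x),
          ENNReal.ofReal_mul (abs_nonneg _)]
    _ = ∑ i ∈ s, ENNReal.ofReal |c i| * μ Set.univ := by
        rw [lintegral_finsetSum _ fun i _ ↦ by fun_prop]
        refine Finset.sum_congr rfl fun i hi ↦ ?_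
        rw [lintegral_const_mul _ (by fun_prop), lintegral_heatExtension μ (ha i hi)]
    _ = _ := by
        rw [ENNReal.ofReal_mul (Finset.sum_nonneg fun _ _ ↦ abs_nonneg _), ofReal_measureReal,
          ENNReal.ofReal_sum_of_nonneg fun _ _ ↦ abs_nonneg _, Finset.sum_mul]

lemma integrable_heatCombination_sq (ha : ∀ i ∈ s, 0 < a i) :
    Integrable (fun x ↦ heatCombination s c a μ x ^ 2) := by
  simp only [heatCombination, sq, Finset.sum_mul_sum]
  refine integrable_finsetSum _ fun i hi ↦ integrable_finsetSum _ fun j hj ↦ ?_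
  simpa only [mul_mul_mul_comm] using
    (integrable_heatExtension_mul μ (ha i hi) (ha j hj)).const_mul (c i * c j)

/-- Plancherel's identity for a linear combination of heat extensions. -/
lemma integral_heatCombination_sq (ha : ∀ i ∈ s, 0 < a i) :
    ∫ x, heatCombination s c a μ x ^ 2 = (2 * Real.pi) ^ (-(finrank ℝ V : ℝ)) *
      ∫ ξ : V, (∑ i ∈ s, c i * Real.exp (-a i * ‖ξ‖ ^ 2)) ^ 2 * ‖charFun μ ξ‖ ^ 2 := by
  have h1 : ∀ x, heatCombination s c a μ x ^ 2 =
      ∑ i ∈ s, ∑ j ∈ s, c i * c j * (heatExtension (a i) μ x * heatExtension (a j) μ x) := by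
    intro x
    simp only [heatCombination, sq, Finset.sum_mul_sum, mul_mul_mul_comm]
  have h2 : ∀ ξ : V, (∑ i ∈ s, c i * Real.exp (-a i * ‖ξ‖ ^ 2)) ^ 2 * ‖charFun μ ξ‖ ^ 2 =
      ∑ i ∈ s, ∑ j ∈ s, c i * c j * (Real.exp (-(a i + a j) * ‖ξ‖ ^ 2) * ‖charFun μ ξ‖ ^ 2) := by
    intro ξ
    rw [sq (∑ i ∈ s, _), Finset.sum_mul_sum, Finset.sum_mul]
    refine Finset.sum_congr rfl fun i _ ↦ ?_
    rw [Finset.sum_mul]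
    refine Finset.sum_congr rfl fun j _ ↦ ?_
    rw [neg_add, add_mul, Real.exp_add]
    ring
  simp_rw [h1, h2]
  have hi1 : ∀ i ∈ s, ∀ j ∈ s, Integrable
      (fun x ↦ c i * c j * (heatExtension (a i) μ x * heatExtension (a j) μ x)) := fun i hi j hj ↦
    (integrable_heatExtension_mul μ (ha i hi) (ha j hj)).const_mul _
  have hi2 : ∀ i ∈ s, ∀ j ∈ s, Integrable (fun ξ : V ↦
      c i * c j * (Real.exp (-(a i + a j) * ‖ξ‖ ^ 2) * ‖charFun μ ξ‖ ^ 2)) := fun i hi j hj ↦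
    (integrable_exp_mul_charFun_sq μ (add_pos (ha i hi) (ha j hj))).const_mul _
  rw [integral_finsetSum _ fun i hi ↦ integrable_finsetSum _ (hi1 i hi),
    integral_finsetSum _ fun i hi ↦ integrable_finsetSum _ (hi2 i hi), Finset.mul_sum]
  refine Finset.sum_congr rfl fun i hi ↦ ?_
  rw [integral_finsetSum _ (hi1 i hi), integral_finsetSum _ (hi2 i hi), Finset.mul_sum]
  refine Finset.sum_congr rfl fun j hj ↦ ?_
  rw [integral_const_mul, integral_const_mul, integral_heatExtension_mul μ (ha i hi) (ha j hj),
    integral_heatExtension_self μ (add_pos (ha i hi) (ha j hj))]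
  ring

/-- If the multiplier of a linear combination of heat extensions, times the characteristic function
of `ν`, is dominated by a Gaussian, then the `L²` norm of that combination for `μ ∗ ν` is dominated
by a Gaussian energy of `μ`. -/
lemma lintegral_enorm_heatCombination_conv_sq_le (ν : Measure V) [IsFiniteMeasure ν]
    (ha : ∀ i ∈ s, 0 < a i) {τ B D : ℝ} (hτ : 0 < τ)
    (hmul : ∀ ξ : V, (∑ i ∈ s, c i * Real.exp (-a i * ‖ξ‖ ^ 2)) ^ 2 * ‖charFun ν ξ‖ ^ 2 ≤
      B * Real.exp (-τ * ‖ξ‖ ^ 2)) (hB : 0 ≤ B) (hD : ∀ x, heatExtension τ μ x ≤ D) :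
    ∫⁻ x, ‖heatCombination s c a (μ ∗ ν) x‖ₑ ^ (2 : ℝ) ≤
      ENNReal.ofReal (B * (D * μ.real Set.univ)) := by
  have h1 : ∀ x, ‖heatCombination s c a (μ ∗ ν) x‖ₑ ^ (2 : ℝ) =
      ENNReal.ofReal (heatCombination s c a (μ ∗ ν) x ^ 2) := by
    intro x
    rw [Real.enorm_eq_ofReal_abs, ENNReal.ofReal_rpow_of_nonneg (abs_nonneg _) (by norm_num),
      Real.rpow_two, sq_abs]
  simp_rw [h1]
  rw [← ofReal_integral_eq_lintegral_ofReal (integrable_heatCombination_sq (μ ∗ ν) ha)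
    (ae_of_all _ fun x ↦ sq_nonneg _), integral_heatCombination_sq _ ha]
  apply ENNReal.ofReal_le_ofReal
  calc _ ≤ (2 * Real.pi) ^ (-(finrank ℝ V : ℝ)) *
        ∫ ξ : V, B * (Real.exp (-τ * ‖ξ‖ ^ 2) * ‖charFun μ ξ‖ ^ 2) := by
        refine mul_le_mul_of_nonneg_left ?_ (by positivity)
        refine integral_mono_of_nonneg (ae_of_all _ fun ξ ↦ by positivity)
          ((integrable_exp_mul_charFun_sq μ hτ).const_mul B) (ae_of_all _ fun ξ ↦ ?_)
        simp only [charFun_conv, norm_mul, mul_pow]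
        calc _ = ((∑ i ∈ s, c i * Real.exp (-a i * ‖ξ‖ ^ 2)) ^ 2 * ‖charFun ν ξ‖ ^ 2)
              * ‖charFun μ ξ‖ ^ 2 := by ring
          _ ≤ (B * Real.exp (-τ * ‖ξ‖ ^ 2)) * ‖charFun μ ξ‖ ^ 2 :=
            mul_le_mul_of_nonneg_right (hmul ξ) (by positivity)
          _ = _ := by ring
    _ = B * ∫ x, heatExtension τ μ x ∂μ := by
        rw [integral_const_mul, integral_heatExtension_self μ hτ]; ring
    _ ≤ B * ∫ _, D ∂μ := by
        refine mul_le_mul_of_nonneg_left ?_ hB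
        exact integral_mono_of_nonneg (ae_of_all _ (heatExtension_nonneg μ hτ))
          (integrable_const _) (ae_of_all _ hD)
    _ = _ := by simp [mul_comm]

end HeatCombination

/-! ### Smoothings at dyadic scales -/

section Multiplier

/-- The coefficients of `1 - (1 - x) ^ M = ∑ j < M, smoothingCoeff M j * x ^ (j + 1)`. -/
def smoothingCoeff (M j : ℕ) : ℝ := (-1) ^ j * M.choose (j + 1)

lemma sum_smoothingCoeff_mul_pow (M : ℕ) (x : ℝ) :
    ∑ j ∈ Finset.range M, smoothingCoeff M j * x ^ (j + 1) = 1 - (1 - x) ^ M := by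
  have h := add_pow (-x) 1 M
  rw [Finset.sum_range_succ'] at h
  rw [show (1 - x) = -x + 1 by ring, h]
  simp only [one_pow, mul_one, pow_zero, Nat.choose_zero_right, Nat.cast_one, sub_add_cancel_right,
    ← Finset.sum_neg_distrib]
  refine Finset.sum_congr rfl fun j _ ↦ ?_
  rw [smoothingCoeff, neg_pow x, pow_succ (-1 : ℝ)]
  ring

lemma sum_smoothingCoeff {M : ℕ} (hM : 1 ≤ M) :
    ∑ j ∈ Finset.range M, smoothingCoeff M j = 1 := by
  have h := sum_smoothingCoeff_mul_pow M 1
  simpa [show M ≠ 0 by omega] using h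

/-- The difference of the multiplier `1 - (1 - exp (-u)) ^ M` at consecutive dyadic scales vanishes
to high order at `0` and decays exponentially at infinity. -/
lemma sq_smoothing_sub_le {M : ℕ} {σ u : ℝ} (hM : 1 ≤ M) (hσ₀ : 0 ≤ σ) (hσ : σ ≤ M) (hu : 0 ≤ u) :
    ((1 - (1 - Real.exp (-(u / 4))) ^ M) - (1 - (1 - Real.exp (-u)) ^ M)) ^ 2 ≤
      2 * M ^ 2 * (u ^ (σ / 2) * Real.exp (-(u / 4))) := by
  have hM' : (1 : ℝ) ≤ M := by exact_mod_cast hM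
  have hM2 : (1 : ℝ) ≤ M ^ 2 := one_le_pow₀ hM'
  set a := 1 - Real.exp (-u) with ha
  set b := 1 - Real.exp (-(u / 4)) with hb
  have hb0 : 0 ≤ b := by
    have : Real.exp (-(u / 4)) ≤ 1 := Real.exp_le_one_iff.2 (by linarith)
    linarith
  have hba : b ≤ a := by
    have : Real.exp (-u) ≤ Real.exp (-(u / 4)) := Real.exp_le_exp.2 (by linarith)
    linarith
  have ha1 : a ≤ 1 := by have := Real.exp_pos (-u); linarith
  have hau : a ≤ u := by have := Real.add_one_le_exp (-u); linarith
  have hpow : b ^ M ≤ a ^ M := by gcongr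
  have hd0 : 0 ≤ (1 - b ^ M) - (1 - a ^ M) := by linarith
  -- for `u ≤ 1` both powers are at most `u ^ M`; for `u ≥ 1` Bernoulli's inequality applies
  rcases le_total u 1 with h | h
  · have h1 : (1 - b ^ M) - (1 - a ^ M) ≤ u ^ M := by
      have : a ^ M ≤ u ^ M := pow_le_pow_left₀ (hb0.trans hba) hau M
      have : 0 ≤ b ^ M := by positivity
      linarith
    have h2 : (u ^ M) ^ 2 ≤ u ^ (σ / 2) := by
      rw [← pow_mul, ← Real.rpow_natCast]
      apply Real.rpow_le_rpow_of_exponent_ge' hu h (by positivity)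
      push_cast; linarith
    have h3 : 1 ≤ 2 * (M : ℝ) ^ 2 * Real.exp (-(u / 4)) := by
      have := Real.add_one_le_exp (-(u / 4))
      nlinarith
    calc _ ≤ (u ^ M) ^ 2 := by gcongr
      _ ≤ u ^ (σ / 2) := h2
      _ ≤ u ^ (σ / 2) * (2 * (M : ℝ) ^ 2 * Real.exp (-(u / 4))) :=
        le_mul_of_one_le_right (by positivity) h3
      _ = _ := by ring
  · have h1 : (1 - b ^ M) - (1 - a ^ M) ≤ M * Real.exp (-(u / 4)) := by
      have h2 := one_add_mul_le_pow (a := -Real.exp (-(u / 4)))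
        (by have : Real.exp (-(u / 4)) ≤ 1 := Real.exp_le_one_iff.2 (by linarith)
            linarith) M
      have h3 : a ^ M ≤ 1 := pow_le_one₀ (hb0.trans hba) ha1
      rw [← sub_eq_add_neg, ← hb] at h2
      linarith
    have h2 : Real.exp (-(u / 4)) ≤ 1 := Real.exp_le_one_iff.2 (by linarith)
    have h3 : 1 ≤ u ^ (σ / 2) := Real.one_le_rpow h (by positivity)
    calc _ ≤ (M * Real.exp (-(u / 4))) ^ 2 := by gcongr
      _ = M ^ 2 * (1 * Real.exp (-(u / 4))) * Real.exp (-(u / 4)) := by ring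
      _ ≤ M ^ 2 * (u ^ (σ / 2) * Real.exp (-(u / 4))) * 1 := by gcongr
      _ ≤ _ := by
        have : 0 ≤ M ^ 2 * (u ^ (σ / 2) * Real.exp (-(u / 4))) := by positivity
        linarith

variable {V : Type*} [NormedAddCommGroup V] [InnerProductSpace ℝ V] [MeasurableSpace V]

/-- The smoothing of a measure at scale `2 ^ (-n)`: the combination of heat extensions with Fourier
multiplier `1 - (1 - exp (-‖ξ‖² / 4 ^ n)) ^ M`. -/
noncomputable def smoothing (M n : ℕ) (μ : Measure V) : V → ℝ :=
  heatCombination (Finset.range M) (smoothingCoeff M) (fun j ↦ (j + 1) / 4 ^ n) μ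

/-- The index set of the difference of two consecutive smoothings. -/
def smoothingDiffIndex (M : ℕ) : Finset (ℕ ⊕ ℕ) := (Finset.range M).disjSum (Finset.range M)

/-- The coefficients of the difference of two consecutive smoothings. -/
def smoothingDiffCoeff (M : ℕ) : ℕ ⊕ ℕ → ℝ :=
  Sum.elim (smoothingCoeff M) (fun j ↦ -smoothingCoeff M j)

/-- The times of the difference of two consecutive smoothings. -/
noncomputable def smoothingDiffTime (n : ℕ) : ℕ ⊕ ℕ → ℝ :=
  Sum.elim (fun j ↦ (j + 1) / 4 ^ (n + 1)) (fun j ↦ (j + 1) / 4 ^ n)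

/-- The difference of two consecutive smoothings, as a combination of heat extensions. -/
noncomputable def smoothingDiff (M n : ℕ) (μ : Measure V) : V → ℝ :=
  heatCombination (smoothingDiffIndex M) (smoothingDiffCoeff M) (smoothingDiffTime n) μ

lemma smoothing_succ_sub (M n : ℕ) (μ : Measure V) (x : V) :
    smoothing M (n + 1) μ x - smoothing M n μ x = smoothingDiff M n μ x := by
  simp [smoothing, smoothingDiff, heatCombination, smoothingDiffIndex, Finset.sum_disjSum,
    smoothingDiffCoeff, smoothingDiffTime, sub_eq_add_neg]

lemma le_smoothingDiffTime (n : ℕ) (i : ℕ ⊕ ℕ) : (4 ^ n)⁻¹ / 4 ≤ smoothingDiffTime n i := by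
  have h : ((4 : ℝ) ^ n)⁻¹ / 4 = 1 / 4 ^ (n + 1) := by rw [pow_succ]; field_simp
  rw [h]
  rcases i with j | j
  · simp only [smoothingDiffTime, Sum.elim_inl]
    gcongr
    linarith [(Nat.cast_nonneg j : (0 : ℝ) ≤ j)]
  · simp only [smoothingDiffTime, Sum.elim_inr]
    gcongr
    · linarith [(Nat.cast_nonneg j : (0 : ℝ) ≤ j)]
    · norm_num
    · omega

lemma smoothingDiffTime_pos (n : ℕ) (i : ℕ ⊕ ℕ) : 0 < smoothingDiffTime n i :=
  lt_of_lt_of_le (by positivity) (le_smoothingDiffTime n i)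

lemma sum_smoothingDiff_exp (M n : ℕ) (r : ℝ) :
    ∑ i ∈ smoothingDiffIndex M, smoothingDiffCoeff M i *
        Real.exp (-smoothingDiffTime n i * r ^ 2) =
      (1 - (1 - Real.exp (-(r ^ 2 / 4 ^ n / 4))) ^ M)
        - (1 - (1 - Real.exp (-(r ^ 2 / 4 ^ n))) ^ M) := by
  rw [← sum_smoothingCoeff_mul_pow, ← sum_smoothingCoeff_mul_pow]
  simp only [smoothingDiffIndex, Finset.sum_disjSum, smoothingDiffCoeff, smoothingDiffTime,
    Sum.elim_inl, Sum.elim_inr, ← Real.exp_nat_mul, neg_mul (smoothingCoeff M _),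
    Finset.sum_neg_distrib, ← sub_eq_add_neg]
  congr 1 <;> refine Finset.sum_congr rfl fun j _ ↦ ?_ <;> congr 2 <;> push_cast
  · rw [pow_succ]; field_simp
  · field_simp

/-- Polynomial Fourier decay of order `σ / 2` of a measure gains a factor `2 ^ (-n σ)` in the square
of the multiplier that belongs to the difference of two consecutive smoothings. -/
lemma smoothingDiff_multiplier_le {ν : Measure V} {M : ℕ} {σ C : ℝ} (hM : 1 ≤ M) (hσ₀ : 0 ≤ σ)
    (hσ : σ ≤ M) (hν : ∀ ξ : V, ‖ξ‖ ^ σ * ‖charFun ν ξ‖ ^ 2 ≤ C) (n : ℕ) (ξ : V) :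
    (∑ i ∈ smoothingDiffIndex M, smoothingDiffCoeff M i *
        Real.exp (-smoothingDiffTime n i * ‖ξ‖ ^ 2)) ^ 2 * ‖charFun ν ξ‖ ^ 2 ≤
      (2 * M ^ 2 * C * (2 ^ n : ℝ) ^ (-σ)) * Real.exp (-((4 ^ n)⁻¹ / 4) * ‖ξ‖ ^ 2) := by
  rw [sum_smoothingDiff_exp]
  have h1 : (‖ξ‖ ^ 2 / 4 ^ n) ^ (σ / 2) = ‖ξ‖ ^ σ * (2 ^ n : ℝ) ^ (-σ) := by
    have h4 : ‖ξ‖ ^ 2 / 4 ^ n = (‖ξ‖ / 2 ^ n) ^ (2 : ℝ) := by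
      rw [Real.rpow_two, div_pow, ← pow_mul, mul_comm n 2, pow_mul]; norm_num
    rw [h4, ← Real.rpow_mul (by positivity), mul_div_cancel₀ _ (two_ne_zero),
      Real.div_rpow (by positivity) (by positivity), Real.rpow_neg (by positivity)]
    rfl
  calc _ ≤ 2 * M ^ 2 * ((‖ξ‖ ^ 2 / 4 ^ n) ^ (σ / 2) * Real.exp (-(‖ξ‖ ^ 2 / 4 ^ n / 4)))
        * ‖charFun ν ξ‖ ^ 2 := by
        gcongr
        exact sq_smoothing_sub_le hM hσ₀ hσ (by positivity)
    _ = 2 * M ^ 2 * (2 ^ n : ℝ) ^ (-σ) * Real.exp (-(‖ξ‖ ^ 2 / 4 ^ n / 4))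
        * (‖ξ‖ ^ σ * ‖charFun ν ξ‖ ^ 2) := by rw [h1]; ring
    _ ≤ 2 * M ^ 2 * (2 ^ n : ℝ) ^ (-σ) * Real.exp (-(‖ξ‖ ^ 2 / 4 ^ n / 4)) * C := by
        gcongr
        exact hν ξ
    _ = _ := by
        rw [show -(((4 : ℝ) ^ n)⁻¹ / 4) * ‖ξ‖ ^ 2 = -(‖ξ‖ ^ 2 / 4 ^ n / 4) by field_simp]
        ring

end Multiplier

/-! ### The estimate at a single scale -/

section ScaleEstimate

variable {d : ℕ}

/-- The estimate at a single scale: `m` bounds the masses of the dyadic cubes of side length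
`2 ^ (-n)`. It interpolates between `L^2`, where the Fourier decay of `ν` gains `2 ^ (-n σ / 2)`,
and `L^1` (if `p ≤ 2`) or `L^∞` (if `2 ≤ p`), where nothing is gained. -/
theorem exists_lintegral_smoothingDiff_conv_le (ν : Measure (EuclideanSpace ℝ (Fin d)))
    [IsProbabilityMeasure ν] {p σ C : ℝ} (hp : 1 < p) (hσ₀ : 0 ≤ σ)
    (hν : ∀ ξ, ‖ξ‖ ^ σ * ‖charFun ν ξ‖ ^ 2 ≤ C) {M : ℕ} (hM : 1 ≤ M) (hσ : σ ≤ M) :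
    ∃ K : ℝ, 0 ≤ K ∧ ∀ (n : ℕ) (m : ℝ) (μ : Measure (EuclideanSpace ℝ (Fin d)))
      [IsFiniteMeasure μ], (∀ k, μ.real (dyadicCube n k) ≤ m) →
      ∫⁻ x, ‖smoothingDiff M n (μ ∗ ν) x‖ₑ ^ p ≤
        ENNReal.ofReal (K * (2 ^ n : ℝ) ^ (d * (p - 1) - σ * min 1 (p - 1)) *
          (m ^ (p - 1) * μ.real Set.univ)) := by
  have hC : 0 ≤ C := le_trans (by positivity) (hν 0)
  set A : ℝ := ∑ i ∈ smoothingDiffIndex M, |smoothingDiffCoeff M i| with hA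
  have hA0 : 0 ≤ A := Finset.sum_nonneg fun _ _ ↦ abs_nonneg _
  set Cd : ℝ := 2 ^ ((d : ℝ) / 2) * Real.exp d with hCd
  have hCd0 : 0 ≤ Cd := by positivity
  set B : ℝ := 2 * M ^ 2 * C with hB
  have hB0 : 0 ≤ B := by positivity
  refine ⟨A ^ (2 - p) * (B * Cd) ^ (p - 1) + (A * Cd) ^ (p - 2) * (B * Cd), by positivity, ?_⟩
  intro n m μ _ hm
  have hm0 : 0 ≤ m := measureReal_nonneg.trans (hm 0)
  set N : ℝ := 2 ^ n with hN
  have hN0 : 0 < N := by positivity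
  set W : ℝ := μ.real Set.univ with hW
  have hW0 : 0 ≤ W := measureReal_nonneg
  have hpos : ∀ i ∈ smoothingDiffIndex M, 0 < smoothingDiffTime n i :=
    fun i _ ↦ smoothingDiffTime_pos n i
  have h1 : ∫⁻ x, ‖smoothingDiff M n (μ ∗ ν) x‖ₑ ≤ ENNReal.ofReal (A * W) := by
    refine (lintegral_enorm_heatCombination_le (μ ∗ ν) hpos).trans_eq ?_
    congr 2
    rw [measureReal_def, Measure.conv, Measure.map_apply (by fun_prop) .univ, Set.preimage_univ,
      ← Set.univ_prod_univ, Measure.prod_prod, measure_univ (μ := ν), mul_one]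
    rfl
  have h0 : ∀ x, |smoothingDiff M n (μ ∗ ν) x| ≤ A * (Cd * N ^ d * m) := fun x ↦
    abs_heatCombination_le (μ ∗ ν) hpos fun i _ ↦
      heatExtension_conv_le μ ν (smoothingDiffTime_pos n i)
        (heatExtension_le_of_dyadicCube_le μ hm (le_smoothingDiffTime n i)) x
  have h2 : ∫⁻ x, ‖smoothingDiff M n (μ ∗ ν) x‖ₑ ^ (2 : ℝ) ≤
      ENNReal.ofReal (B * N ^ (-σ) * (Cd * N ^ d * m * W)) :=
    lintegral_enorm_heatCombination_conv_sq_le μ ν hpos (by positivity)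
      (smoothingDiff_multiplier_le hM hσ₀ hσ hν n) (by positivity)
      (heatExtension_le_of_dyadicCube_le μ hm le_rfl)
  rcases le_total p 2 with hp2 | hp2
  · refine (lintegral_enorm_rpow_le_of_le_two (by unfold smoothingDiff; fun_prop) hp.le hp2
      (by positivity) (by positivity) h1 h2).trans (ENNReal.ofReal_le_ofReal ?_)
    rw [min_eq_right (by linarith)]
    calc (A * W) ^ (2 - p) * (B * N ^ (-σ) * (Cd * N ^ d * m * W)) ^ (p - 1)
        = A ^ (2 - p) * (B * Cd) ^ (p - 1) * (N ^ (-σ) * N ^ d) ^ (p - 1) *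
            (m ^ (p - 1) * (W ^ (2 - p) * W ^ (p - 1))) := by
          rw [show B * N ^ (-σ) * (Cd * N ^ d * m * W) =
              (B * Cd) * (N ^ (-σ) * N ^ d) * m * W by ring,
            Real.mul_rpow hA0 hW0, Real.mul_rpow (by positivity) hW0,
            Real.mul_rpow (by positivity) hm0,
            Real.mul_rpow (x := B * Cd) (by positivity) (by positivity)]
          ring
      _ = A ^ (2 - p) * (B * Cd) ^ (p - 1) * N ^ (d * (p - 1) - σ * (p - 1)) *
            (m ^ (p - 1) * W) := by
          congr 2
          · rw [← Real.rpow_natCast N, ← Real.rpow_add hN0, ← Real.rpow_mul hN0.le]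
            congr 1; ring
          · rw [← Real.rpow_add_of_nonneg hW0 (by linarith) (by linarith)]
            norm_num
      _ ≤ _ := by
          gcongr
          exact le_add_of_nonneg_right (by positivity)
  · refine (lintegral_enorm_rpow_le_of_two_le hp2 (by positivity) h0 h2).trans
      (ENNReal.ofReal_le_ofReal ?_)
    rw [min_eq_left (by linarith), mul_one]
    calc (A * (Cd * N ^ d * m)) ^ (p - 2) * (B * N ^ (-σ) * (Cd * N ^ d * m * W))
        = (A * Cd) ^ (p - 2) * (B * Cd) * ((N ^ d) ^ (p - 2) * N ^ d * N ^ (-σ)) *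
            ((m ^ (p - 2) * m) * W) := by
          rw [show A * (Cd * N ^ d * m) = (A * Cd) * N ^ d * m by ring,
            Real.mul_rpow (by positivity) hm0, Real.mul_rpow (by positivity) (by positivity)]
          ring
      _ = (A * Cd) ^ (p - 2) * (B * Cd) * N ^ (d * (p - 1) - σ) * (m ^ (p - 1) * W) := by
          congr 2
          · rw [← Real.rpow_natCast N, ← Real.rpow_mul hN0.le, ← Real.rpow_add hN0,
              ← Real.rpow_add hN0]
            congr 1; ring
          · nth_rewrite 2 [← Real.rpow_one m]
            rw [← Real.rpow_add_of_nonneg hm0 (by linarith) (by linarith)]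
            congr 1; ring
      _ ≤ _ := by
          gcongr
          exact le_add_of_nonneg_left (by positivity)

end ScaleEstimate

/-! ### Level sets of the dyadic masses -/

section LevelSets

lemma sum_restrict_preimage_singleton {α β : Type*} [MeasurableSpace α] [MeasurableSpace β]
    [MeasurableSingletonClass β] (μ : Measure α) {f : α → β} (hf : Measurable f) (t : Finset β)
    (ht : ∀ x, f x ∈ t) : ∑ b ∈ t, μ.restrict (f ⁻¹' {b}) = μ := by
  ext s hs
  have h := sum_measure_preimage_singleton (μ := μ.restrict s) t (f := f)
    fun b _ ↦ hf (measurableSet_singleton b)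
  rw [show f ⁻¹' (t : Set β) = Set.univ from Set.eq_univ_of_forall ht, Measure.restrict_apply_univ]
    at h
  rw [← h, Measure.finsetSum_apply]
  refine Finset.sum_congr rfl fun b _ ↦ ?_
  rw [Measure.restrict_apply hs, Measure.restrict_apply (hf (measurableSet_singleton b)),
    Set.inter_comm]

variable {d : ℕ} (μ : Measure (EuclideanSpace ℝ (Fin d)))

/-- The level `j` of a dyadic cube with `2 ^ (-j - 1) < μ(I) ≤ 2 ^ (-j)`, cut off at `J`. Cubes of
measure zero have level `0`. -/
noncomputable def dyadicLevel (n J : ℕ) (k : Fin d → ℤ) : ℕ :=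
  min J ⌊-Real.logb 2 (μ.real (dyadicCube n k))⌋₊

/-- The restriction of `μ` to the dyadic cubes of level `j`. -/
noncomputable def levelPart (n J j : ℕ) : Measure (EuclideanSpace ℝ (Fin d)) :=
  μ.restrict ((fun x ↦ dyadicLevel μ n J (dyadicIndex n x)) ⁻¹' {j})

instance [IsFiniteMeasure μ] (n J j : ℕ) : IsFiniteMeasure (levelPart μ n J j) := by
  unfold levelPart; infer_instance

lemma measurable_dyadicLevel (n J : ℕ) :
    Measurable (fun x ↦ dyadicLevel μ n J (dyadicIndex n x)) :=
  (measurable_of_countable (dyadicLevel μ n J)).comp (measurable_dyadicIndex n)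

lemma sum_levelPart (n J : ℕ) : ∑ j ∈ Finset.range (J + 1), levelPart μ n J j = μ :=
  sum_restrict_preimage_singleton μ (measurable_dyadicLevel μ n J) _ fun _ ↦
    Finset.mem_range_succ_iff.2 (min_le_left _ _)

variable [IsProbabilityMeasure μ]

lemma summable_dyadic_rpow {q : ℝ} (hq : 1 ≤ q) (n : ℕ) :
    Summable fun k : Fin d → ℤ ↦ μ.real (dyadicCube n k) ^ q := by
  have h : ∑' k : Fin d → ℤ, μ (dyadicCube n k) = 1 := by
    have h := tsum_measure_preimage_singleton (μ := μ) (Set.countable_univ (α := Fin d → ℤ))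
      (f := dyadicIndex n) fun k _ ↦ measurable_dyadicIndex n (measurableSet_singleton k)
    rw [Set.preimage_univ, measure_univ, tsum_univ (fun k ↦ μ (dyadicIndex n ⁻¹' {k}))] at h
    simpa only [dyadicCube_eq_preimage] using h
  have hs : Summable fun k : Fin d → ℤ ↦ μ.real (dyadicCube n k) :=
    ENNReal.summable_toReal (by rw [h]; exact ENNReal.one_ne_top)
  refine hs.of_nonneg_of_le (fun k ↦ by positivity) fun k ↦ ?_
  exact Real.rpow_le_self_of_le_one measureReal_nonneg measureReal_le_one hq

lemma levelPart_dyadicCube_le (n J j : ℕ) (k : Fin d → ℤ) :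
    (levelPart μ n J j).real (dyadicCube n k) ≤ (2 ^ j)⁻¹ := by
  rw [levelPart, measureReal_restrict_apply (measurableSet_dyadicCube n k)]
  by_cases hj : dyadicLevel μ n J k = j
  · refine (measureReal_mono Set.inter_subset_left).trans ?_
    rcases measureReal_nonneg (μ := μ) (s := dyadicCube n k) |>.eq_or_lt with h0 | h0
    · rw [← h0]; positivity
    have h1 : (j : ℝ) ≤ -Real.logb 2 (μ.real (dyadicCube n k)) := by
      rw [← Nat.le_floor_iff (neg_nonneg.2 <| Real.logb_nonpos (by norm_num) h0.le
        measureReal_le_one), ← hj]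
      exact min_le_right _ _
    rw [le_neg, Real.logb_le_iff_le_rpow (by norm_num) h0, Real.rpow_neg (by norm_num)] at h1
    simpa using h1
  · have : dyadicCube n k ∩ (fun x ↦ dyadicLevel μ n J (dyadicIndex n x)) ⁻¹' {j} = ∅ := by
      ext x
      simp only [dyadicCube_eq_preimage, Set.mem_inter_iff, Set.mem_preimage,
        Set.mem_singleton_iff, Set.mem_empty_iff_false, iff_false, not_and]
      rintro rfl
      exact hj
    rw [this]; simp

/-- On a level part, the upper bound `2 ^ (-j)` of the masses of the cubes, raised to the power
`p - 1`, times the total mass is at most a constant times the moment sum. For `j < J` this holds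
since the cubes have comparable masses, for `j = J` by the choice of `J`. -/
lemma rpow_mul_levelPart_univ_le {p : ℝ} (hp : 1 < p) {n J j : ℕ} (hj : j ≤ J) {S : ℝ}
    (hS : dyadicMomentSum p μ n ≤ S) (hJ : ((2 ^ J)⁻¹ : ℝ) ^ (p - 1) ≤ S) :
    ((2 ^ j)⁻¹ : ℝ) ^ (p - 1) * (levelPart μ n J j).real Set.univ ≤ 2 ^ (p - 1) * S := by
  have hS0 : 0 ≤ S := le_trans (by positivity) hJ
  have h2 : (1 : ℝ) ≤ 2 ^ (p - 1) := Real.one_le_rpow (by norm_num) (by linarith)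
  rw [levelPart, measureReal_restrict_apply_univ]
  rcases hj.eq_or_lt with rfl | hj
  · calc _ ≤ ((2 ^ j)⁻¹ : ℝ) ^ (p - 1) * 1 := by gcongr; exact measureReal_le_one
      _ ≤ 1 * S := by linarith
      _ ≤ _ := by gcongr
  -- on a cube of level `j < J` the mass is larger than `2 ^ (-j - 1)`
  have hcube : ∀ k, dyadicLevel μ n J k = j → ((2 ^ j)⁻¹ : ℝ) ^ (p - 1) * μ.real (dyadicCube n k) ≤
      2 ^ (p - 1) * μ.real (dyadicCube n k) ^ p := by
    intro k hk
    rcases measureReal_nonneg (μ := μ) (s := dyadicCube n k) |>.eq_or_lt with h0 | h0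
    · rw [← h0, mul_zero]; positivity
    have h1 : -Real.logb 2 (μ.real (dyadicCube n k)) < j + 1 := by
      have h2 : ⌊-Real.logb 2 (μ.real (dyadicCube n k))⌋₊ < j + 1 := by
        unfold dyadicLevel at hk
        omega
      exact_mod_cast Nat.lt_of_floor_lt h2
    rw [neg_lt, Real.lt_logb_iff_rpow_lt (by norm_num) h0, Real.rpow_neg (by norm_num)] at h1
    have h3 : (2 ^ j)⁻¹ ≤ 2 * μ.real (dyadicCube n k) := by
      have : ((2 : ℝ) ^ ((j : ℝ) + 1))⁻¹ = (2 ^ j)⁻¹ / 2 := by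
        rw [Real.rpow_add (by norm_num)]; simp; ring
      linarith
    calc _ ≤ (2 * μ.real (dyadicCube n k)) ^ (p - 1) * μ.real (dyadicCube n k) := by
          gcongr
      _ = 2 ^ (p - 1) *
          (μ.real (dyadicCube n k) ^ (p - 1) * μ.real (dyadicCube n k) ^ (1 : ℝ)) := by
          rw [Real.mul_rpow (by norm_num) h0.le, Real.rpow_one]; ring
      _ = _ := by rw [← Real.rpow_add h0]; norm_num
  have hsum : (μ ((fun x ↦ dyadicLevel μ n J (dyadicIndex n x)) ⁻¹' {j})) =
      ∑' k : {k | dyadicLevel μ n J k = j}, μ (dyadicCube n k) := by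
    have h := tsum_measure_preimage_singleton (μ := μ)
      (Set.to_countable {k | dyadicLevel μ n J k = j})
      (f := dyadicIndex n) fun k _ ↦ measurable_dyadicIndex n (measurableSet_singleton k)
    simp only [dyadicCube_eq_preimage]
    exact h.symm
  rw [← ENNReal.ofReal_le_ofReal_iff (by positivity), ENNReal.ofReal_mul (by positivity),
    ofReal_measureReal, hsum, ← ENNReal.tsum_mul_left]
  calc ∑' k : {k | dyadicLevel μ n J k = j},
        ENNReal.ofReal (((2 ^ j)⁻¹ : ℝ) ^ (p - 1)) * μ (dyadicCube n k)
      ≤ ∑' k : {k | dyadicLevel μ n J k = j},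
          ENNReal.ofReal (2 ^ (p - 1) * μ.real (dyadicCube n k) ^ p) := by
        refine ENNReal.tsum_le_tsum fun k ↦ ?_
        rw [← ofReal_measureReal, ← ENNReal.ofReal_mul (by positivity)]
        exact ENNReal.ofReal_le_ofReal (hcube k k.2)
    _ ≤ ∑' k, ENNReal.ofReal (2 ^ (p - 1) * μ.real (dyadicCube n k) ^ p) :=
        ENNReal.tsum_comp_le_tsum_of_injective Subtype.val_injective _
    _ = ENNReal.ofReal (2 ^ (p - 1) * dyadicMomentSum p μ n) := by
        rw [← ENNReal.ofReal_tsum_of_nonneg (fun k ↦ by positivity)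
          ((summable_dyadic_rpow μ hp.le n).mul_left _), tsum_mul_left]
        rfl
    _ ≤ _ := by gcongr

/-- The estimate of the difference of consecutive smoothings of `μ ∗ ν` by the moment sum of `μ`.
Splitting `μ` into the `J + 1` level parts reduces it to measures that give comparable masses to
all cubes that they charge, at the cost of the factor `J + 1`. -/
theorem exists_eLpNorm_smoothingDiff_conv_le (ν : Measure (EuclideanSpace ℝ (Fin d)))
    [IsProbabilityMeasure ν] {p σ C : ℝ} (hp : 1 < p) (hσ₀ : 0 ≤ σ)
    (hν : ∀ ξ, ‖ξ‖ ^ σ * ‖charFun ν ξ‖ ^ 2 ≤ C) {M : ℕ} (hM : 1 ≤ M) (hσ : σ ≤ M) :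
    ∃ K : ℝ, 0 ≤ K ∧ ∀ (n J : ℕ) (S : ℝ), dyadicMomentSum p μ n ≤ S →
      ((2 ^ J)⁻¹ : ℝ) ^ (p - 1) ≤ S →
      eLpNorm (smoothingDiff M n (μ ∗ ν)) (ENNReal.ofReal p) volume ≤
        ENNReal.ofReal ((J + 1) *
          (K * (2 ^ n : ℝ) ^ (d * (p - 1) - σ * min 1 (p - 1)) * S) ^ (1 / p)) := by
  obtain ⟨K, hK0, hK⟩ := exists_lintegral_smoothingDiff_conv_le ν hp hσ₀ hν hM hσ
  refine ⟨K * 2 ^ (p - 1), by positivity, fun n J S hS hJ ↦ ?_⟩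
  have hS0 : 0 ≤ S := le_trans (by positivity) hJ
  have hdec : smoothingDiff M n (μ ∗ ν) =
      ∑ j ∈ Finset.range (J + 1), smoothingDiff M n (levelPart μ n J j ∗ ν) := by
    have hconv : μ ∗ ν = ∑ j ∈ Finset.range (J + 1), levelPart μ n J j ∗ ν := by
      conv_lhs => rw [← sum_levelPart μ n J]
      generalize Finset.range (J + 1) = t
      induction t using Finset.induction_on with
      | empty => simp
      | insert j t hj ih => rw [Finset.sum_insert hj, Finset.sum_insert hj, Measure.add_conv, ih]
    ext x
    rw [Finset.sum_apply]
    conv_lhs => rw [hconv]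
    exact heatCombination_finset_sum _ _ _ (fun i _ ↦ smoothingDiffTime_pos n i) x
  have hpiece : ∀ j ∈ Finset.range (J + 1),
      eLpNorm (smoothingDiff M n (levelPart μ n J j ∗ ν)) (ENNReal.ofReal p) volume ≤
        ENNReal.ofReal ((K * 2 ^ (p - 1) *
          (2 ^ n : ℝ) ^ (d * (p - 1) - σ * min 1 (p - 1)) * S) ^ (1 / p)) := by
    intro j hj
    rw [eLpNorm_eq_lintegral_rpow_enorm_toReal (by simpa using by linarith) ENNReal.ofReal_ne_top,
      ENNReal.toReal_ofReal (by linarith), ← ENNReal.ofReal_rpow_of_nonneg (by positivity)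
      (by positivity)]
    gcongr
    refine (hK n _ (levelPart μ n J j) (levelPart_dyadicCube_le μ n J j)).trans
      (ENNReal.ofReal_le_ofReal ?_)
    have := rpow_mul_levelPart_univ_le μ hp (Finset.mem_range_succ_iff.1 hj) hS hJ
    calc _ ≤ K * (2 ^ n : ℝ) ^ (d * (p - 1) - σ * min 1 (p - 1)) * (2 ^ (p - 1) * S) := by gcongr
      _ = _ := by ring
  rw [hdec]
  refine (eLpNorm_sum_le (fun j _ ↦ ?_) (by simpa using hp.le)).trans ?_
  · exact (measurable_heatCombination _ _ _ _).aestronglyMeasurable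
  · refine (Finset.sum_le_sum hpiece).trans_eq ?_
    rw [Finset.sum_const, Finset.card_range, nsmul_eq_mul, ENNReal.ofReal_mul (by positivity)]
    congr 1
    rw [← Nat.cast_add_one, ENNReal.ofReal_natCast]

end LevelSets

/-! ### Weak convergence of the smoothings -/

section WeakConvergence

lemma memLp_of_integrable_of_bound {α : Type*} [MeasurableSpace α] {μ : Measure α} {f : α → ℝ}
    {p A : ℝ} (hp : 1 ≤ p) (hf : Integrable f μ) (hA : ∀ x, |f x| ≤ A) :
    MemLp f (ENNReal.ofReal p) μ := by
  refine ⟨hf.1, ?_⟩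
  rw [eLpNorm_lt_top_iff_lintegral_rpow_enorm_lt_top (by simpa using by linarith)
    ENNReal.ofReal_ne_top, ENNReal.toReal_ofReal (by linarith)]
  calc ∫⁻ x, ‖f x‖ₑ ^ p ∂μ ≤ ∫⁻ x, ENNReal.ofReal A ^ (p - 1) * ‖f x‖ₑ ∂μ := by
        refine lintegral_mono fun x ↦ ?_
        have h : ‖f x‖ₑ ^ p = ‖f x‖ₑ ^ (p - 1) * ‖f x‖ₑ ^ (1 : ℝ) := by
          rw [← ENNReal.rpow_add_of_nonneg _ _ (by linarith) (by linarith)]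
          congr 1; ring
        rw [h, ENNReal.rpow_one]
        gcongr
        rw [Real.enorm_eq_ofReal_abs]
        exact ENNReal.ofReal_le_ofReal (hA x)
    _ = ENNReal.ofReal A ^ (p - 1) * ∫⁻ x, ‖f x‖ₑ ∂μ :=
        lintegral_const_mul' _ _ (ENNReal.rpow_ne_top_of_nonneg (by linarith) ENNReal.ofReal_ne_top)
    _ < ∞ := ENNReal.mul_lt_top
        (ENNReal.rpow_lt_top_of_nonneg (by linarith) ENNReal.ofReal_ne_top) hf.2

variable {V : Type*} [NormedAddCommGroup V] [InnerProductSpace ℝ V] [FiniteDimensional ℝ V]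
  [MeasurableSpace V] [BorelSpace V]

/-- The heat kernel is an approximation of the identity. -/
lemma tendsto_integral_heatKernel_mul {g : V → ℝ} (hg : Integrable g) {x : V}
    (hx : ContinuousAt g x) :
    Tendsto (fun t ↦ ∫ y, heatKernel t (x - y) * g y) (𝓝[>] 0) (𝓝 (g x)) := by
  have hg' : Integrable (fun y ↦ (g y : ℂ)) := hg.ofReal
  have h := Real.tendsto_integral_gaussian_smul' (v := x) hg'
    (Complex.continuous_ofReal.continuousAt.comp hx)
  have hc : Tendsto (fun t : ℝ ↦ (4 * Real.pi ^ 2)⁻¹ * t⁻¹) (𝓝[>] 0) atTop :=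
    tendsto_inv_nhdsGT_zero.const_mul_atTop (by positivity)
  have h2 := Complex.continuous_re.continuousAt.tendsto.comp (h.comp hc)
  rw [Complex.ofReal_re] at h2
  refine h2.congr' ?_
  filter_upwards [self_mem_nhdsWithin] with t ht
  have ht : 0 < t := ht
  simp only [Function.comp_apply]
  rw [← Complex.ofReal_re (∫ y, heatKernel t (x - y) * g y), ← integral_complex_ofReal]
  have hker : ∀ z : V, ((heatKernel t z : ℝ) : ℂ) =
      (Real.pi * ((4 * Real.pi ^ 2)⁻¹ * t⁻¹ : ℝ) : ℂ) ^ (finrank ℝ V / 2 : ℂ) *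
        Complex.exp (-Real.pi ^ 2 * ((4 * Real.pi ^ 2)⁻¹ * t⁻¹ : ℝ) * ‖z‖ ^ 2) := by
    intro z
    set c : ℝ := (4 * Real.pi ^ 2)⁻¹ * t⁻¹ with hc
    have hc0 : 0 < c := by positivity
    have e1 : Real.pi * c = (4 * Real.pi * t)⁻¹ := by rw [hc]; field_simp
    have e2 : Real.pi ^ 2 * c = (4 * t)⁻¹ := by rw [hc]; field_simp
    unfold heatKernel
    rw [neg_div, Real.rpow_neg (by positivity), ← Real.inv_rpow (by positivity), ← e1, ← e2]
    push_cast [Complex.ofReal_cpow (show 0 ≤ Real.pi * c by positivity)]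
    congr 2
    ring
  congr 2
  ext y
  rw [smul_eq_mul, Complex.ofReal_mul (heatKernel t (x - y)), hker]

variable (μ : Measure V) [IsFiniteMeasure μ]

lemma integral_mul_heatExtension {t : ℝ} (ht : 0 < t) {g : V → ℝ} (hg : Continuous g)
    (hgi : Integrable g) :
    ∫ x, g x * heatExtension t μ x = ∫ y, (∫ x, heatKernel t (y - x) * g x) ∂μ := by
  unfold heatExtension
  simp_rw [← integral_const_mul]
  rw [integral_integral_swap]
  · refine integral_congr_ae (ae_of_all _ fun y ↦ ?_)
    refine integral_congr_ae (ae_of_all _ fun x ↦ ?_)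
    simp only
    rw [heatKernel_sub_comm, mul_comm]
  · have h : Integrable (fun q : V × V ↦ g q.1 * (1 : ℝ)) (volume.prod μ) :=
      hgi.mul_prod (integrable_const 1)
    refine (h.mul_const ((4 * Real.pi * t) ^ (-(finrank ℝ V : ℝ) / 2))).mono
      (Continuous.aestronglyMeasurable (by unfold Function.uncurry; fun_prop))
      (ae_of_all _ fun q ↦ ?_)
    simp only [Function.uncurry, mul_one, norm_mul]
    gcongr
    rw [Real.norm_of_nonneg (heatKernel_nonneg ht _)]
    exact (heatKernel_le ht _).trans (Real.le_norm_self _)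

lemma tendsto_integral_mul_heatExtension (g : C_c(V, ℝ)) :
    Tendsto (fun t ↦ ∫ x, g x * heatExtension t μ x) (𝓝[>] 0) (𝓝 (∫ x, g x ∂μ)) := by
  have hgi : Integrable g (volume : Measure V) := g.integrable
  obtain ⟨B, hB⟩ := g.hasCompactSupport.exists_bound_of_continuous g.continuous
  have h : Tendsto (fun t ↦ ∫ y, (∫ x, heatKernel t (y - x) * g x) ∂μ) (𝓝[>] 0)
      (𝓝 (∫ x, g x ∂μ)) := by
    refine tendsto_integral_filter_of_dominated_convergence (fun _ ↦ B) ?_ ?_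
      (integrable_const _) (ae_of_all _ fun y ↦
        tendsto_integral_heatKernel_mul hgi g.continuous.continuousAt)
    · refine Eventually.of_forall fun t ↦ ?_
      have : Continuous (fun q : V × V ↦ heatKernel t (q.1 - q.2) * g q.2) := by
        have := g.continuous
        fun_prop
      exact this.stronglyMeasurable.integral_prod_right.aestronglyMeasurable
    · filter_upwards [self_mem_nhdsWithin] with t ht
      have ht : 0 < t := ht
      refine ae_of_all _ fun y ↦ ?_
      calc ‖∫ x, heatKernel t (y - x) * g x‖ ≤ ∫ x, heatKernel t (y - x) * B := by
            refine norm_integral_le_of_norm_le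
              (((integrable_heatKernel ht).comp_sub_left y).mul_const B) (ae_of_all _ fun x ↦ ?_)
            rw [norm_mul, Real.norm_of_nonneg (heatKernel_nonneg ht _)]
            exact mul_le_mul_of_nonneg_left (hB x) (heatKernel_nonneg ht _)
        _ = B := by
            rw [integral_mul_const, integral_sub_left_eq_self (fun x : V ↦ heatKernel t x),
              integral_heatKernel ht, one_mul]
  refine h.congr' ?_
  filter_upwards [self_mem_nhdsWithin] with t ht
  exact (integral_mul_heatExtension μ ht g.continuous hgi).symm

/-- The smoothings of a measure converge to it weakly. -/
lemma tendsto_integral_mul_smoothing {M : ℕ} (hM : 1 ≤ M) (g : C_c(V, ℝ)) :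
    Tendsto (fun n ↦ ∫ x, g x * smoothing M n μ x) atTop (𝓝 (∫ x, g x ∂μ)) := by
  have hpos : ∀ n j : ℕ, (0 : ℝ) < (j + 1) / 4 ^ n := fun n j ↦ by positivity
  have htime : ∀ j : ℕ, Tendsto (fun n : ℕ ↦ ((j : ℝ) + 1) / 4 ^ n) atTop (𝓝[>] 0) := fun j ↦
    tendsto_nhdsWithin_iff.2 ⟨tendsto_const_nhds.div_atTop
      (tendsto_pow_atTop_atTop_of_one_lt (by norm_num)), Eventually.of_forall fun n ↦ hpos n j⟩
  have h : ∀ n, ∫ x, g x * smoothing M n μ x =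
      ∑ j ∈ Finset.range M, smoothingCoeff M j *
        ∫ x, g x * heatExtension ((j + 1) / 4 ^ n) μ x := by
    intro n
    simp_rw [← integral_const_mul]
    rw [← integral_finsetSum]
    · refine integral_congr_ae (ae_of_all _ fun x ↦ ?_)
      simp only [smoothing, heatCombination, Finset.mul_sum]
      exact Finset.sum_congr rfl fun j _ ↦ by ring
    · intro j _
      obtain ⟨B, hB⟩ := g.hasCompactSupport.exists_bound_of_continuous g.continuous
      exact ((integrable_heatExtension μ (hpos n j)).bdd_mul
        g.continuous.aestronglyMeasurable (ae_of_all _ hB)).const_mul _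
  simp_rw [h]
  have h1 : ∫ x, g x ∂μ = ∑ j ∈ Finset.range M, smoothingCoeff M j * ∫ x, g x ∂μ := by
    rw [← Finset.sum_mul, sum_smoothingCoeff hM, one_mul]
  rw [h1]
  exact tendsto_finsetSum _ fun j _ ↦
    ((tendsto_integral_mul_heatExtension μ g).comp (htime j)).const_mul _

lemma memLp_smoothing (M n : ℕ) {p : ℝ} (hp : 1 ≤ p) :
    MemLp (smoothing M n μ) (ENNReal.ofReal p) volume := by
  have h : ∀ j ∈ Finset.range M, MemLp (fun x ↦ smoothingCoeff M j *
      heatExtension ((j + 1) / 4 ^ n) μ x) (ENNReal.ofReal p) volume := by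
    intro j _
    have ht : (0 : ℝ) < (j + 1) / 4 ^ n := by positivity
    refine MemLp.const_mul (memLp_of_integrable_of_bound
      (A := (4 * Real.pi * ((j + 1) / 4 ^ n)) ^ (-(finrank ℝ V : ℝ) / 2) * μ.real Set.univ)
      hp (integrable_heatExtension μ ht) fun x ↦ ?_) _
    rw [abs_of_nonneg (heatExtension_nonneg μ ht x)]
    exact heatExtension_le μ ht x
  exact memLp_finsetSum _ h

end WeakConvergence

/-! ### Densities in `L^p` from weak limits -/

section Limit

variable {V : Type*} [NormedAddCommGroup V] [InnerProductSpace ℝ V] [FiniteDimensional ℝ V]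
  [MeasurableSpace V] [BorelSpace V]

/-- Completeness of `L^p` for a sequence with summable increments, stated for functions. -/
lemma exists_memLp_tendsto_of_summable {α : Type*} [MeasurableSpace α] {μ : Measure α}
    {p : ℝ≥0∞} (hp : 1 ≤ p) {f : ℕ → α → ℝ} (hf : ∀ n, MemLp (f n) p μ) {b : ℕ → ℝ}
    (hb : ∀ n, 0 ≤ b n) (hfb : ∀ n, eLpNorm (f (n + 1) - f n) p μ ≤ ENNReal.ofReal (b n))
    (hbs : Summable b) :
    ∃ F, MemLp F p μ ∧ Tendsto (fun n ↦ eLpNorm (f n - F) p μ) atTop (𝓝 0) := by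
  have : Fact (1 ≤ p) := ⟨hp⟩
  have hc : CauchySeq fun n ↦ (hf n).toLp (f n) := by
    refine cauchySeq_of_dist_le_of_summable b (fun n ↦ ?_) hbs
    rw [dist_comm, Lp.dist_def, ← ENNReal.ofReal_le_ofReal_iff (hb n), ENNReal.ofReal_toReal]
    · refine (eLpNorm_congr_ae ?_).trans_le (hfb n)
      exact (hf (n + 1)).coeFn_toLp.sub (hf n).coeFn_toLp
    · refine ne_of_lt (((Lp.memLp _).sub (Lp.memLp _)).2)
  obtain ⟨F, hF⟩ := cauchySeq_tendsto_of_complete hc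
  refine ⟨F, Lp.memLp F, ?_⟩
  rw [← Lp.tendsto_Lp_iff_tendsto_eLpNorm'' f hf F (Lp.memLp F)]
  simpa using hF

/-- A finite measure that integrates test functions like a function `F ∈ L^p` is absolutely
continuous with a density in `L^p`. -/
lemma exists_density_of_integral_eq {p : ℝ} (hp : 1 ≤ p) (ρ : Measure V) [IsFiniteMeasure ρ]
    {F : V → ℝ} (hF : MemLp F (ENNReal.ofReal p) volume)
    (h : ∀ g : C_c(V, ℝ), ∫ x, g x ∂ρ = ∫ x, g x * F x) :
    ρ ≪ volume ∧ ∃ f : V → ℝ, (∀ x, 0 ≤ f x) ∧ MemLp f (ENNReal.ofReal p) volume ∧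
      ρ = volume.withDensity fun x => ENNReal.ofReal (f x) := by
  have hloc : LocallyIntegrable F volume := hF.locallyIntegrable (by simpa using hp)
  -- the identity `ρ + F⁻ dx = F⁺ dx`, tested on continuous functions of compact support
  have hdom : ρ ≤ volume.withDensity fun x ↦ ENNReal.ofReal (F x) := by
    have hm := hF.1.aemeasurable
    have hmn : AEMeasurable (fun x ↦ ENNReal.ofReal (-F x)) volume := by fun_prop
    have hfin : ∀ G : V → ℝ, LocallyIntegrable G volume →
        IsLocallyFiniteMeasure (volume.withDensity fun x ↦ ENNReal.ofReal (G x)) := by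
      intro G hG
      refine ⟨fun x ↦ ?_⟩
      obtain ⟨U, hU, hGU⟩ := hG x
      obtain ⟨U', hU', hopen, hx⟩ := mem_nhds_iff.1 hU
      refine ⟨U', hopen.mem_nhds hx, ?_⟩
      rw [withDensity_apply _ hopen.measurableSet]
      exact (hGU.mono_set hU').lintegral_lt_top
    have := hfin F hloc
    have := hfin (fun x ↦ -F x) hloc.neg
    have : IsLocallyFiniteMeasure
        (ρ + volume.withDensity (fun x ↦ ENNReal.ofReal (-F x))) := by
      refine ⟨fun x ↦ ?_⟩
      obtain ⟨U, hU, hlt⟩ :=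
        (volume.withDensity (fun x ↦ ENNReal.ofReal (-F x))).finiteAt_nhds x
      exact ⟨U, hU, by
        rw [Measure.add_apply]; exact ENNReal.add_lt_top.2 ⟨measure_lt_top _ _, hlt⟩⟩
    have heq : ρ + volume.withDensity (fun x ↦ ENNReal.ofReal (-F x)) =
        volume.withDensity fun x ↦ ENNReal.ofReal (F x) := by
      refine Measure.ext_of_integral_eq_on_compactlySupported fun g ↦ ?_
      have hgF : Integrable (fun x ↦ g x * F x) volume := by
        simpa using hloc.integrable_smul_left_of_hasCompactSupport g.continuous
          g.hasCompactSupport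
      have hgn : Integrable (fun x ↦ (ENNReal.ofReal (-F x)).toReal • g x) volume := by
        refine hgF.mono (hmn.ennreal_toReal.aestronglyMeasurable.smul
          g.continuous.aestronglyMeasurable) (ae_of_all _ fun x ↦ ?_)
        rw [smul_eq_mul, mul_comm, norm_mul, norm_mul, ENNReal.toReal_ofReal',
          Real.norm_of_nonneg (le_max_right _ _)]
        gcongr
        exact max_le (neg_le_abs _) (abs_nonneg _)
      rw [integral_add_measure g.integrable g.integrable, h,
        integral_withDensity_eq_integral_toReal_smul₀ hmn
          (ae_of_all _ fun _ ↦ ENNReal.ofReal_lt_top),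
        integral_withDensity_eq_integral_toReal_smul₀ hm.ennreal_ofReal
          (ae_of_all _ fun _ ↦ ENNReal.ofReal_lt_top), ← integral_add hgF hgn]
      refine integral_congr_ae (ae_of_all _ fun x ↦ ?_)
      simp only [ENNReal.toReal_ofReal', smul_eq_mul]
      rcases le_total (F x) 0 with hx | hx
      · rw [max_eq_left (by linarith), max_eq_right hx]; ring
      · rw [max_eq_right (by linarith), max_eq_left hx]; ring
    rw [← heq]
    exact Measure.le_add_right le_rfl
  have hac : ρ ≪ volume :=
    (Measure.absolutelyContinuous_of_le hdom).trans (withDensity_absolutelyContinuous _ _)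
  refine ⟨hac, fun x ↦ (ρ.rnDeriv volume x).toReal, fun x ↦ ENNReal.toReal_nonneg, ?_, ?_⟩
  · have hle : ρ.rnDeriv volume ≤ᵐ[volume] fun x ↦ ENNReal.ofReal (F x) := by
      refine ae_le_of_forall_setLIntegral_le_of_sigmaFinite (Measure.measurable_rnDeriv _ _)
        fun s hs _ ↦ ?_
      rw [Measure.setLIntegral_rnDeriv hac, ← withDensity_apply _ hs]
      exact hdom s
    refine hF.mono (Measure.measurable_rnDeriv _ _).ennreal_toReal.aestronglyMeasurable ?_
    filter_upwards [hle] with x hx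
    rw [Real.norm_of_nonneg ENNReal.toReal_nonneg]
    calc _ ≤ (ENNReal.ofReal (F x)).toReal := ENNReal.toReal_mono ENNReal.ofReal_ne_top hx
      _ ≤ _ := by rw [ENNReal.toReal_ofReal']; exact max_le (Real.le_norm_self _) (norm_nonneg _)
  · nth_rewrite 1 [← Measure.withDensity_rnDeriv_eq ρ volume hac]
    refine withDensity_congr_ae ?_
    filter_upwards [Measure.rnDeriv_lt_top ρ volume] with x hx
    rw [ENNReal.ofReal_toReal hx.ne]

/-- A limit in `L^p` that is also a weak limit to a measure represents this measure. -/
lemma integral_eq_of_tendsto {p : ℝ} (hp : 1 < p) (ρ : Measure V) {f : ℕ → V → ℝ} {F : V → ℝ}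
    (hf : ∀ n, MemLp (f n) (ENNReal.ofReal p) volume) (hF : MemLp F (ENNReal.ofReal p) volume)
    (hfF : Tendsto (fun n ↦ eLpNorm (f n - F) (ENNReal.ofReal p) volume) atTop (𝓝 0))
    {g : C_c(V, ℝ)}
    (hw : Tendsto (fun n ↦ ∫ x, g x * f n x) atTop (𝓝 (∫ x, g x ∂ρ))) :
    ∫ x, g x ∂ρ = ∫ x, g x * F x := by
  have hq := (Real.HolderConjugate.conjExponent hp).ennrealOfReal
  have hg : MemLp g (ENNReal.ofReal p.conjExponent) (volume : Measure V) :=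
    g.continuous.memLp_of_hasCompactSupport g.hasCompactSupport
  have : ENNReal.HolderTriple (ENNReal.ofReal p.conjExponent) (ENNReal.ofReal p) 1 :=
    ENNReal.HolderConjugate.symm (p := ENNReal.ofReal p)
  refine tendsto_nhds_unique hw (tendsto_integral_of_L1' _ ?_ ?_ ?_)
  · exact hg.1.mul hF.1
  · exact Eventually.of_forall fun n ↦ memLp_one_iff_integrable.1 ((hf n).mul hg)
  · have hb : ∀ n, eLpNorm ((fun x ↦ g x * f n x) - fun x ↦ g x * F x) 1 volume ≤
        eLpNorm g (ENNReal.ofReal p.conjExponent) volume *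
          eLpNorm (f n - F) (ENNReal.ofReal p) volume := by
      intro n
      have := eLpNorm_smul_le_mul_eLpNorm (p := ENNReal.ofReal p.conjExponent)
        (q := ENNReal.ofReal p) (r := 1) ((hf n).sub hF).1 hg.1
      refine le_trans (le_of_eq ?_) this
      congr 1
      ext x
      simp [mul_sub]
    refine tendsto_of_tendsto_of_tendsto_of_le_of_le tendsto_const_nhds ?_ (fun _ ↦ zero_le) hb
    simpa using ENNReal.Tendsto.const_mul hfF (Or.inr hg.2.ne)

end Limit

/-! ### Exponents below the two dimensions -/

section Parameters

variable {d : ℕ}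

lemma measureFourier_eq_charFun (ν : Measure (EuclideanSpace ℝ (Fin d)))
    (ξ : EuclideanSpace ℝ (Fin d)) : measureFourier ν ξ = charFun ν (Real.pi • ξ) := by
  rw [charFun_apply, measureFourier]
  refine integral_congr_ae (ae_of_all _ fun x ↦ ?_)
  simp only [inner_smul_right]
  congr 1
  push_cast; ring

/-- Any real number below the Fourier dimension of `ν` lies below an exponent `σ` of polynomial
decay of the characteristic function. -/
lemma exists_charFun_decay_of_lt_fourierDim (ν : Measure (EuclideanSpace ℝ (Fin d)))
    [IsProbabilityMeasure ν] {x : EReal} (hx : x < fourierDim ν) :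
    ∃ σ : ℝ, x < σ ∧ 0 ≤ σ ∧ ∃ C : ℝ, ∀ ξ, ‖ξ‖ ^ σ * ‖charFun ν ξ‖ ^ 2 ≤ C := by
  obtain ⟨_, ⟨σ, rfl, hσ, hO⟩, hxσ⟩ := lt_sSup_iff.1 hx
  refine ⟨σ, hxσ, hσ, ?_⟩
  obtain ⟨c, hc⟩ := hO.bound
  obtain ⟨R, -, hR⟩ := (hasBasis_cobounded_norm.eventually_iff).1 hc
  have hpi := Real.pi_pos
  set R' := max R 1 with hR'
  have hR'0 : 0 < R' := lt_of_lt_of_le one_pos (le_max_right _ _)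
  refine ⟨(Real.pi * R') ^ σ + Real.pi ^ σ * c ^ 2, fun ξ ↦ ?_⟩
  set η := Real.pi⁻¹ • ξ with hη
  have hξ : ξ = Real.pi • η := by rw [hη, smul_inv_smul₀ hpi.ne']
  have hnorm : ‖ξ‖ = Real.pi * ‖η‖ := by
    rw [hξ, norm_smul, Real.norm_of_nonneg hpi.le]
  rcases le_total ‖η‖ R' with h | h
  · calc ‖ξ‖ ^ σ * ‖charFun ν ξ‖ ^ 2 ≤ (Real.pi * R') ^ σ * 1 ^ 2 := by
          rw [hnorm]
          gcongr
          exact norm_charFun_le_one ξ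
      _ ≤ _ := by
          rw [one_pow, mul_one]
          exact le_add_of_nonneg_right (by positivity)
  · have hη0 : 0 < ‖η‖ := hR'0.trans_le h
    have h1 := hR ((le_max_left R 1).trans h : R ≤ ‖η‖)
    rw [measureFourier_eq_charFun, ← hξ, Real.norm_of_nonneg (by positivity)] at h1
    have h2 : (‖η‖ ^ (-σ / 2)) ^ 2 = (‖η‖ ^ σ)⁻¹ := by
      rw [← Real.rpow_natCast, ← Real.rpow_mul hη0.le, ← Real.rpow_neg hη0.le]
      congr 1; push_cast; ring
    calc ‖ξ‖ ^ σ * ‖charFun ν ξ‖ ^ 2 ≤ (Real.pi * ‖η‖) ^ σ * (c * ‖η‖ ^ (-σ / 2)) ^ 2 := by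
          rw [hnorm]
          gcongr
      _ = Real.pi ^ σ * c ^ 2 := by
          rw [Real.mul_rpow hpi.le hη0.le, mul_pow, h2]
          field_simp
      _ ≤ _ := le_add_of_nonneg_left (by positivity)

/-- Below the `L^p` dimension the moment sums decay at the corresponding rate. -/
lemma eventually_dyadicMomentSum_le {p D : ℝ} (hp : 1 < p)
    (μ : Measure (EuclideanSpace ℝ (Fin d))) (hD : (D : EReal) < lqDim p μ) :
    ∀ᶠ n : ℕ in atTop, dyadicMomentSum p μ n ≤ (2 ^ n : ℝ) ^ (-((p - 1) * D)) := by
  filter_upwards [eventually_lt_of_lt_liminf hD, eventually_ge_atTop 1] with n hn hn1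
  have hn0 : (0 : ℝ) < n := by exact_mod_cast hn1
  rw [EReal.coe_lt_coe_iff, lt_div_iff_of_neg (by nlinarith)] at hn
  have hS : 0 ≤ dyadicMomentSum p μ n := tsum_nonneg fun k ↦ by positivity
  -- a vanishing moment sum is treated apart because of the junk value `logb 2 0 = 0`
  rcases hS.eq_or_lt with h | h
  · rw [← h]; positivity
  · rw [← Real.rpow_natCast, ← Real.rpow_mul (by norm_num),
      ← Real.logb_le_iff_le_rpow (by norm_num) h]
    linarith

/-- An inequality in the extended reals leaves room for a real number strictly below `L`. -/
lemma exists_lt_of_mul_sub_lt {c a σ : ℝ} (hc : 0 < c) {L : EReal}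
    (h : (c : EReal) * ((a : EReal) - L) < σ) : ∃ D : ℝ, (D : EReal) < L ∧ c * (a - D) < σ := by
  induction L with
  | bot =>
    rw [EReal.coe_sub_bot, EReal.coe_mul_top_of_pos hc] at h
    exact absurd h not_top_lt
  | top =>
    refine ⟨a - σ / c + 1, EReal.coe_lt_top _, ?_⟩
    have : c * (a - (a - σ / c + 1)) = σ - c := by field_simp; ring
    linarith
  | coe l =>
    norm_cast at h
    refine ⟨l - (σ - c * (a - l)) / (2 * c), ?_, ?_⟩
    · norm_cast
      have : 0 < (σ - c * (a - l)) / (2 * c) := div_pos (by linarith) (by linarith)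
      linarith
    · have : c * (a - (l - (σ - c * (a - l)) / (2 * c))) =
        c * (a - l) + (σ - c * (a - l)) / 2 := by field_simp; ring
      linarith

end Parameters

/-! ### Absolute continuity of the convolution -/

section AbsoluteContinuity

variable {d : ℕ}

lemma summable_linear_mul_geometric (a b : ℝ) {r : ℝ} (hr0 : 0 ≤ r) (hr : r < 1) :
    Summable fun n : ℕ ↦ (n * a + 1) * (b * r ^ n) := by
  have h1 := (summable_pow_mul_geometric_of_norm_lt_one 1
    (by rwa [Real.norm_of_nonneg hr0] : ‖r‖ < 1)).mul_left (a * b)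
  have h2 := (summable_geometric_of_lt_one hr0 hr).mul_left b
  refine (h1.add h2).congr fun n ↦ ?_
  ring

/-- The theorem in terms of exponents: `D` is an exponent of decay of the moment sums of `μ` and `σ`
is an exponent of decay of the squared characteristic function of `ν`. -/
theorem absolutelyContinuous_conv_of_decay {p σ C D : ℝ} (hp : 1 < p)
    (μ ν : Measure (EuclideanSpace ℝ (Fin d))) [IsProbabilityMeasure μ] [IsProbabilityMeasure ν]
    (hσ₀ : 0 ≤ σ) (hν : ∀ ξ, ‖ξ‖ ^ σ * ‖charFun ν ξ‖ ^ 2 ≤ C)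
    (hμ : ∀ᶠ n : ℕ in atTop, dyadicMomentSum p μ n ≤ (2 ^ n : ℝ) ^ (-((p - 1) * D)))
    (hlt : (p - 1) * (d - D) < σ * min 1 (p - 1)) :
    (μ ∗ ν) ≪ volume ∧ HasLpDensity p (μ ∗ ν) := by
  set M : ℕ := max 1 ⌈σ⌉₊ with hMdef
  have hM : 1 ≤ M := le_max_left _ _
  have hσM : σ ≤ M := (Nat.le_ceil σ).trans (by exact_mod_cast le_max_right _ _)
  obtain ⟨K, hK0, hK⟩ := exists_eLpNorm_smoothingDiff_conv_le μ ν hp hσ₀ hν hM hσM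
  obtain ⟨n₀, hn₀⟩ := eventually_atTop.1 hμ
  set ε : ℝ := (σ * min 1 (p - 1) - (p - 1) * (d - D)) / p with hε
  have hε0 : 0 < ε := div_pos (by linarith) (by linarith)
  -- the cut-off level `J = n ⌈D⌉` makes the remainder obey the same bound as the level parts
  set b : ℕ → ℝ := fun n ↦ (n * (⌈D⌉₊ : ℝ) + 1) * (K ^ (1 / p) * (2 ^ (-ε)) ^ n) with hb
  have hb0 : ∀ n, 0 ≤ b n := fun n ↦ by positivity
  have hbs : Summable b := summable_linear_mul_geometric _ _ (by positivity)
    (Real.rpow_lt_one_of_one_lt_of_neg (by norm_num) (by linarith))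
  have hdiff : ∀ n, n₀ ≤ n →
      eLpNorm (smoothing M (n + 1) (μ ∗ ν) - smoothing M n (μ ∗ ν)) (ENNReal.ofReal p) volume ≤
        ENNReal.ofReal (b n) := by
    intro n hn
    have hfun : smoothing M (n + 1) (μ ∗ ν) - smoothing M n (μ ∗ ν) =
        smoothingDiff M n (μ ∗ ν) := by
      ext x; exact smoothing_succ_sub M n _ x
    rw [hfun]
    refine (hK n (n * ⌈D⌉₊) _ (hn₀ n hn) ?_).trans_eq ?_
    · rw [← Real.rpow_natCast 2 (n * ⌈D⌉₊), ← Real.rpow_natCast 2 n, ← Real.rpow_neg (by norm_num),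
        ← Real.rpow_mul (by norm_num), ← Real.rpow_mul (by norm_num)]
      apply Real.rpow_le_rpow_of_exponent_le (by norm_num)
      push_cast
      have h1 : (n : ℝ) * D ≤ n * ⌈D⌉₊ := by gcongr; exact Nat.le_ceil D
      nlinarith
    · congr 1
      simp only [hb]
      push_cast
      congr 1
      rw [mul_assoc, ← Real.rpow_add (by positivity), Real.mul_rpow hK0 (by positivity)]
      congr 1
      rw [← Real.rpow_natCast, ← Real.rpow_natCast, ← Real.rpow_mul (by norm_num),
        ← Real.rpow_mul (by norm_num), ← Real.rpow_mul (by norm_num)]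
      congr 1
      rw [hε]; field_simp; ring
  obtain ⟨F, hF, hlim⟩ := exists_memLp_tendsto_of_summable
    (f := fun n ↦ smoothing M (n + n₀) (μ ∗ ν)) (b := fun n ↦ b (n + n₀))
    (by simpa using hp.le : 1 ≤ ENNReal.ofReal p) (fun n ↦ memLp_smoothing _ M _ hp.le)
    (fun n ↦ hb0 _) (fun n ↦ by
      rw [add_right_comm]; exact hdiff _ (Nat.le_add_left _ _))
    ((summable_nat_add_iff n₀).2 hbs)
  refine exists_density_of_integral_eq hp.le _ hF fun g ↦ ?_
  exact integral_eq_of_tendsto hp _ (fun n ↦ memLp_smoothing _ M _ hp.le) hF hlim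
    ((tendsto_integral_mul_smoothing _ hM g).comp (tendsto_add_atTop_nat n₀))

end AbsoluteContinuity

theorem mainTheorem6 (d : ℕ) (p : ℝ) (hp : 1 < p)
    (μ ν : Measure (EuclideanSpace ℝ (Fin d)))
    [IsProbabilityMeasure μ] [IsProbabilityMeasure ν] (hμ : IsCompact μ.support) :
    (((p ≤ 2 ∧ (d : EReal) - lqDim p μ < fourierDim ν) ∨
        (2 < p ∧ ((p - 1 : ℝ) : EReal) * ((d : EReal) - lqDim p μ) < fourierDim ν)) →
      (μ ∗ ν) ≪ volume ∧ HasLpDensity p (μ ∗ ν)) ∧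
    ((lqDim p μ = (d : EReal) ∧ 0 < fourierDim ν) →
      (μ ∗ ν) ≪ volume ∧ HasLpDensity p (μ ∗ ν)) := by
  have key : ((p ≤ 2 ∧ (d : EReal) - lqDim p μ < fourierDim ν) ∨
        (2 < p ∧ ((p - 1 : ℝ) : EReal) * ((d : EReal) - lqDim p μ) < fourierDim ν)) →
      (μ ∗ ν) ≪ volume ∧ HasLpDensity p (μ ∗ ν) := by
    rintro (⟨hp2, h⟩ | ⟨hp2, h⟩)
    · obtain ⟨σ, hlt, hσ₀, C, hC⟩ := exists_charFun_decay_of_lt_fourierDim ν h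
      obtain ⟨D, hD, hDσ⟩ := exists_lt_of_mul_sub_lt (c := 1) (a := d) one_pos
        (by simpa using hlt)
      refine absolutelyContinuous_conv_of_decay hp μ ν hσ₀ hC
        (eventually_dyadicMomentSum_le hp μ hD) ?_
      rw [min_eq_right (by linarith), mul_comm σ]
      exact mul_lt_mul_of_pos_left (by linarith) (by linarith)
    · obtain ⟨σ, hlt, hσ₀, C, hC⟩ := exists_charFun_decay_of_lt_fourierDim ν h
      obtain ⟨D, hD, hDσ⟩ := exists_lt_of_mul_sub_lt (c := p - 1) (a := d) (by linarith)
        (by simpa using hlt)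
      refine absolutelyContinuous_conv_of_decay hp μ ν hσ₀ hC
        (eventually_dyadicMomentSum_le hp μ hD) ?_
      rwa [min_eq_left (by linarith), mul_one]
  refine ⟨key, fun ⟨hdim, hpos⟩ ↦ key ?_⟩
  have h0 : (d : EReal) - lqDim p μ = 0 := by
    rw [hdim]
    exact EReal.sub_self (EReal.natCast_ne_top d) (EReal.natCast_ne_bot d)
  rw [h0, mul_zero]
  rcases le_or_gt p 2 with h | h
  · exact Or.inl ⟨h, hpos⟩
  · exact Or.inr ⟨h, hpos⟩
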